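/- All spaces are topological spaces and all maps are continuous. A subset $U\subset X$ is *ambiently contractible* if the inclusion $U\to X$ is nullhomotopic (homotopic to a constant map). A cover $\{U_\alpha\}_{\alpha\in A}$ of $X$ is *numerable* if there is a partition of unity $\{f_\alpha:X\to[0,1]\}_{\alpha\in A}$ such that the closed supports $\operatorname{Supp}(f_\alpha)$ form a locally finite family and $\operatorname{Supp}(f_\alpha)\subset U_\alpha$ for all $\alpha$. A space is a *Dold space* (numerably contractible space) if it has a numerable cover by ambiently contractible sets. A based space $(X,x_0)$ is *wellpointed* if the inclusion $\{x_0\}\subset X$ is a closed cofibration. For a small category $J$ and a diagram $D:J\to\mathrm{Top}$, the homotopy colimit $\operatorname{hocolim} D$ is the (slim) topological realization of the simplicial space $$[n]\longmapsto \coprod_{j_0\to j_1\to\cdots\to j_n} D(j_0),$$ where the coproduct runs over all chains of $n$ composable morphisms of $J$; a monotone map $\varphi:[m]\to[n]$ restricts a chain to $j_{\varphi(0)}\to\cdots\to j_{\varphi(m)}$ and acts on points by $D(j_0\to j_{\varphi(0)})$. For a diagram $D:J\to\mathrm{Top}^*$ of based spaces and based maps, the inclusions of the base points define a map $BJ\to\operatorname{hocolim}D$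 from the classifying space $BJ$ (the realization of the nerve of $J$), and the based homotopy colimit is the quotient $(\operatorname{hocolim}D)/BJ$, based at the image of $BJ$ (a single point if $J$ is empty). Let $J$ be a small category. 1. If $D:J\to\mathrm{Top}$ is a diagram of Dold spaces, then $\operatorname{hocolim}D$ is a Dold space. 2. If $D:J\to\mathrm{Top}^*$ is a diagram of wellpointed Dold spaces and based maps, then the based homotopy colimit $(\operatorname{hocolim}D)/BJ$ is a wellpointed Dold space. -/

import Mathlib

open CategoryTheory Opposite

universe u

namespace NumerablyContractible

section Dold

/-- The inclusion of a subspace. -/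
def incl {X : Type u} [TopologicalSpace X] (s : Set X) : C(s, X) :=
  ⟨Subtype.val, continuous_subtype_val⟩

/-- A subset is ambiently contractible if its inclusion into the whole space is nullhomotopic. -/
def IsAmbientlyContractible {X : Type u} [TopologicalSpace X] (s : Set X) : Prop :=
  (incl s).Nullhomotopic

/-- A family of subsets of `X` is a numerable cover if it covers `X` and admits a numeration: a
partition of unity whose (closed) supports form a locally finite family and are contained,
index by index, in the members of the family. -/
def IsNumerableCover {X : Type u} [TopologicalSpace X] {ι : Type u} (U : ι → Set X) : Prop :=
  (⋃ i, U i) = Set.univ ∧ ∃ f : PartitionOfUnity ι X Set.univ, f.IsSubordinate U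

/-- A Dold cover is a numerable cover by ambiently contractible sets. -/
def IsDoldCover {X : Type u} [TopologicalSpace X] {ι : Type u} (U : ι → Set X) : Prop :=
  IsNumerableCover U ∧ ∀ i, IsAmbientlyContractible (U i)

/-- A Dold space (numerably contractible space) is a space that has a Dold cover. -/
def IsDoldSpace (X : Type u) [TopologicalSpace X] : Prop :=
  ∃ (ι : Type u) (U : ι → Set X), IsDoldCover U

end Dold

section Cofibrations

/-- The homotopy extension property of a map `i : A → X` for all target spaces. -/
def HasHomotopyExtension {A X : Type u} [TopologicalSpace A] [TopologicalSpace X]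
    (i : C(A, X)) : Prop :=
  ∀ (Y : Type u) [TopologicalSpace Y] (f : C(X, Y)) (h : C(A × unitInterval, Y)),
    (∀ a, h (a, 0) = f (i a)) →
      ∃ H : C(X × unitInterval, Y), (∀ x, H (x, 0) = f x) ∧ ∀ a t, H (i a, t) = h (a, t)

/-- A based space is wellpointed if the inclusion of the base point is a closed cofibration. -/
def IsWellpointed (X : Type u) [TopologicalSpace X] (x₀ : X) : Prop :=
  IsClosed ({x₀} : Set X) ∧ HasHomotopyExtension (incl ({x₀} : Set X))

end Cofibrations

section Realization

/-- The disjoint union of the spaces `Xₙ × Δⁿ`. -/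
abbrev PreRealization (X : SimplicialObject TopCat.{u}) : Type u :=
  Σ n : SimplexCategory, X.obj (op n) × SimplexCategory.toTop₀.obj n

/-- The relation `(φ^* x, t) ∼ (x, φ_* t)`, for all morphisms `φ` of the simplex category (faces
and degeneracies), that generates the equivalence relation of the slim realization. -/
inductive RealizationRel (X : SimplicialObject TopCat.{u}) :
    PreRealization X → PreRealization X → Prop
  | glue {m n : SimplexCategory} (φ : m ⟶ n) (x : X.obj (op n))
      (t : SimplexCategory.toTop₀.obj m) :
      RealizationRel X ⟨m, X.map φ.op x, t⟩ ⟨n, x, SimplexCategory.toTop₀.map φ t⟩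

/-- The (slim) topological realization of a simplicial space, with the quotient topology. -/
def Realization (X : SimplicialObject TopCat.{u}) : Type u := Quot (RealizationRel X)

instance (X : SimplicialObject TopCat.{u}) : TopologicalSpace (Realization X) :=
  inferInstanceAs (TopologicalSpace (Quot (RealizationRel X)))

/-- The map on realizations induced by a map of simplicial spaces. -/
def Realization.map {X Y : SimplicialObject TopCat.{u}} (F : X ⟶ Y) :
    C(Realization X, Realization Y) where
  toFun := Quot.map (fun p => ⟨p.1, F.app (op p.1) p.2.1, p.2.2⟩) (by
    rintro _ _ ⟨φ, x, t⟩
    have h := RealizationRel.glue (X := Y) φ (F.app _ x) t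
    rwa [← NatTrans.naturality_apply F φ.op x] at h)
  continuous_toFun := by
    refine continuous_quot_lift _ (continuous_quot_mk.comp ?_)
    exact continuous_sigma fun n => continuous_sigmaMk.comp
      ((F.app (op n)).hom.continuous.prodMap continuous_id)

end Realization

section Hocolim

variable {J : Type u} [SmallCategory J]

/-- The coproduct of the spaces `D (j₀)` over all chains `j₀ ⟶ j₁ ⟶ ⋯ ⟶ jₙ` in `J`. -/
abbrev ReplacementSpace (D : J ⥤ TopCat.{u}) (n : ℕ) : Type u :=
  Σ σ : ComposableArrows J n, D.obj (σ.obj 0)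

/-- A morphism `φ` restricts a chain along `φ` and applies `D` to the composite morphism of the
chain from `j₀` to the new first object. -/
def replacementMap (D : J ⥤ TopCat.{u}) {Δ Δ' : SimplexCategoryᵒᵖ} (φ : Δ ⟶ Δ') :
    C(ReplacementSpace D Δ.unop.len, ReplacementSpace D Δ'.unop.len) where
  toFun p := ⟨(nerve J).map φ p.1,
    D.map (p.1.map (homOfLE (Fin.zero_le (φ.unop.toOrderHom 0)))) p.2⟩
  continuous_toFun := continuous_sigma fun σ =>
    (continuous_sigmaMk (σ := fun τ : ComposableArrows J Δ'.unop.len => D.obj (τ.obj 0))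
      (i := (nerve J).map φ σ)).comp
        (D.map (σ.map (homOfLE (Fin.zero_le (φ.unop.toOrderHom 0))))).hom.continuous

/-- The simplicial replacement of a diagram `D : J ⥤ Top`: its space of `n`-simplices is the
coproduct of the spaces `D (j₀)` over all chains `j₀ ⟶ j₁ ⟶ ⋯ ⟶ jₙ` in `J`. -/
def simplicialReplacement (D : J ⥤ TopCat.{u}) : SimplicialObject TopCat.{u} where
  obj Δ := TopCat.of (ReplacementSpace D Δ.unop.len)
  map φ := TopCat.ofHom (replacementMap D φ)
  map_id Δ := by
    refine TopCat.hom_ext (ContinuousMap.ext ?_)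
    rintro ⟨σ, x⟩
    have h : D.map (σ.map (𝟙 0)) = 𝟙 _ := (congrArg D.map (σ.map_id 0)).trans (D.map_id _)
    exact congrArg (Sigma.mk (β := fun τ : ComposableArrows J Δ.unop.len => D.obj (τ.obj 0)) σ)
      (ConcreteCategory.congr_hom h x)
  map_comp {Δ Δ' Δ''} φ ψ := by
    refine TopCat.hom_ext (ContinuousMap.ext ?_)
    rintro ⟨σ, x⟩
    have h : σ.map (homOfLE (Fin.zero_le ((φ ≫ ψ).unop.toOrderHom 0))) =
        σ.map (homOfLE (Fin.zero_le (φ.unop.toOrderHom 0))) ≫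
          σ.map (homOfLE (φ.unop.toOrderHom.monotone
            (Fin.zero_le (ψ.unop.toOrderHom 0)))) := by
      rw [← σ.map_comp]; rfl
    exact congrArg (Sigma.mk (β := fun τ : ComposableArrows J Δ''.unop.len => D.obj (τ.obj 0))
      ((nerve J).map (φ ≫ ψ) σ))
        (ConcreteCategory.congr_hom ((congrArg D.map h).trans (D.map_comp _ _)) x)

/-- The homotopy colimit of a diagram of spaces. -/
abbrev Hocolim (D : J ⥤ TopCat.{u}) : Type u := Realization (simplicialReplacement D)

variable (J) in
/-- The nerve of `J`, as a simplicial discrete space. -/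
abbrev discreteNerve : SimplicialObject TopCat.{u} := nerve J ⋙ TopCat.discrete

variable (J) in
/-- The classifying space `BJ`. -/
abbrev ClassifyingSpace : Type u := Realization (discreteNerve J)

/-- The category of based spaces: spaces under the one-point space. -/
abbrev BasedTop : Type (u + 1) := Under (TopCat.of PUnit.{u + 1})

/-- The base point of a based space. -/
def BasedTop.pt (X : BasedTop.{u}) : X.right := X.hom PUnit.unit

/-- The underlying diagram of spaces of a diagram of based spaces. -/
abbrev underlying (D : J ⥤ BasedTop.{u}) : J ⥤ TopCat.{u} := D ⋙ Under.forget _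

/-- The inclusions of the base points, as a map of simplicial spaces from the nerve of `J` to the
simplicial replacement: it sends a chain `j₀ ⟶ ⋯ ⟶ jₙ` to the base point of `D (j₀)` in the
summand of that chain. -/
def basePointInclusion (D : J ⥤ BasedTop.{u}) :
    discreteNerve J ⟶ simplicialReplacement (underlying D) where
  app Δ := TopCat.ofHom (X := TopCat.discrete.obj ((nerve J).obj Δ))
    (Y := TopCat.of (ReplacementSpace (underlying D) Δ.unop.len))
    { toFun := fun (σ : ComposableArrows J Δ.unop.len) => ⟨σ, BasedTop.pt (D.obj (σ.obj 0))⟩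
      continuous_toFun := continuous_bot }
  naturality Δ Δ' φ := by
    refine TopCat.hom_ext (ContinuousMap.ext ?_)
    intro (σ : ComposableArrows J Δ.unop.len)
    exact congrArg (Sigma.mk
      (β := fun τ : ComposableArrows J Δ'.unop.len => (underlying D).obj (τ.obj 0))
      ((nerve J).map φ σ)) (ConcreteCategory.congr_hom
      (Under.w (D.map (σ.map (homOfLE (Fin.zero_le (φ.unop.toOrderHom 0)))))) PUnit.unit).symm

/-- The map `BJ → hocolim D` defined by the inclusions of the base points. -/
def classifyingSpaceMap (D : J ⥤ BasedTop.{u}) :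
    C(ClassifyingSpace J, Hocolim (underlying D)) :=
  Realization.map (basePointInclusion D)

/-- The relation on `X ⊔ *` that identifies all points of the image of `i : A → X` with `*`. -/
inductive CollapseRel {A X : Type u} [TopologicalSpace A] [TopologicalSpace X] (i : C(A, X)) :
    X ⊕ PUnit.{u + 1} → X ⊕ PUnit.{u + 1} → Prop
  | glue (a : A) : CollapseRel i (Sum.inl (i a)) (Sum.inr PUnit.unit)

/-- The quotient `X / A` along a map `i : A → X`, i.e. the pushout of `* ← A → X`. (If `A` is empty,
this is `X` with a disjoint base point.) -/
def Collapse {A X : Type u} [TopologicalSpace A] [TopologicalSpace X] (i : C(A, X)) : Type u :=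
  Quot (CollapseRel i)

instance {A X : Type u} [TopologicalSpace A] [TopologicalSpace X] (i : C(A, X)) :
    TopologicalSpace (Collapse i) :=
  inferInstanceAs (TopologicalSpace (Quot (CollapseRel i)))

/-- The base point of `X / A`. -/
def Collapse.pt {A X : Type u} [TopologicalSpace A] [TopologicalSpace X] (i : C(A, X)) :
    Collapse i :=
  Quot.mk _ (Sum.inr PUnit.unit)

/-- The based homotopy colimit `(hocolim D) / BJ` of a diagram of based spaces. -/
abbrev BasedHocolim (D : J ⥤ BasedTop.{u}) : Type u := Collapse (classifyingSpaceMap D)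

/-- The base point of the based homotopy colimit. -/
abbrev BasedHocolim.pt (D : J ⥤ BasedTop.{u}) : BasedHocolim D :=
  Collapse.pt (classifyingSpaceMap D)

end Hocolim

end NumerablyContractible

/-! A point of the homotopy colimit is a point of `D (j₀)` with barycentric coordinates on a chain
`j₀ ⟶ ⋯ ⟶ jₙ`, up to faces and degeneracies. Around the open cells of dimension `k` the simplex
coordinate can be pushed linearly to a vertex, which deforms a neighbourhood into the coproduct of
the spaces `D j`. This coproduct is a Dold space, and Dold covers pull back along such deformations
over a numerable cover (`isDoldSpace_of_partitionOfUnity`).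

The neighbourhoods and the chosen vertex must be compatible with degeneracies, that is, with
identities in chains. For this, `colorMass σ k t` is the largest mass that `t` puts on a set of
vertices whose chain degenerates to at most `k` objects; it is continuous and descends to the
homotopy colimit. Where it jumps sufficiently from `k` to `k + 1`, any two sets of large mass with
`k + 1` groups have first groups consisting of vertices that are all joined by identities
(`linked_of_firstWeight_pos`). The weighted average of these vertices is the target of the
deformation (`homotopic_vertexMap`).

In the based case, a homotopy prescribed at the base point of the quotient is a single path, so it
pulls back to the same path at every point of `BJ`. It is extended by induction over skeleta
(`exists_extension_hocolim`). One step extends from `Y × ∂Δⁿ ∪ {y₀} × Δⁿ` to `Y × Δⁿ`, and the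
uniqueness of nondegenerate presentations (`eq_of_cell_eq`) makes the extensions on different cells
fit together. Homotopies are treated as maps to the path space, so that continuity can be tested on
cells. Finally, a wellpointed quotient of a Dold space is a Dold space (`Collapse.isDoldSpace`): one
contractible neighbourhood handles the base point, and elsewhere the projection is open and
injective. -/

namespace NumerablyContractible

/-! ### Partitions of unity from nonnegative functions -/

section Numerations

open Topology

/-- Only the open supports are controlled, so the functions are cut off to shrink their closed
supports: with `S = ∑ f i` and `Q = ∑ (f i)²`, keep only the part where `f i * S / Q` is not small.
-/
theorem exists_partitionOfUnity_of_support_subset {X ι : Type*} [TopologicalSpace X]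
    {U : ι → Set X} (f : ι → C(X, ℝ)) (hf : LocallyFinite fun i => Function.support (f i))
    (h0 : ∀ i x, 0 ≤ f i x) (hpos : ∀ x, ∃ i, 0 < f i x)
    (hU : ∀ i, Function.support (f i) ⊆ U i) :
    ∃ p : PartitionOfUnity ι X Set.univ, p.IsSubordinate U := by
  have hf2 : LocallyFinite fun i => Function.support (fun x => f i x * f i x) :=
    hf.subset fun i x hx => by
      simp only [Function.mem_support, ne_eq, mul_self_eq_zero] at hx ⊢; exact hx
  let S : X → ℝ := fun x => ∑ᶠ i, f i x
  let Q : X → ℝ := fun x => ∑ᶠ i, f i x * f i x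
  have hS : Continuous S := continuous_finsum (fun i => (f i).continuous) hf
  have hQ : Continuous Q :=
    continuous_finsum (fun i => (f i).continuous.mul (f i).continuous) hf2
  have hle : ∀ i x, f i x * f i x ≤ Q x := fun i x =>
    single_le_finsum (f := fun i => f i x * f i x) i (hf2.point_finite x)
      fun j => mul_self_nonneg _
  have hQpos : ∀ x, 0 < Q x := fun x => by
    obtain ⟨i, hi⟩ := hpos x
    exact (mul_pos hi hi).trans_le (hle i x)
  -- Otherwise multiplying `f i x * S x < Q x` by `f i x` and summing over `i` gives `Q x * S x < S
  -- x * Q x`.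
  have hmax : ∀ x, ∃ i, Q x ≤ f i x * S x := by
    intro x
    by_contra! hcon
    have hfin := hf.point_finite x
    have hS' : S x = ∑ i ∈ hfin.toFinset, f i x :=
      finsum_eq_sum_of_support_subset _ (by intro i hi; simpa using hi)
    have hQ' : Q x = ∑ i ∈ hfin.toFinset, f i x * f i x :=
      finsum_eq_sum_of_support_subset _ (by intro i hi; simpa using hi)
    obtain ⟨i, hi⟩ := hpos x
    have : ∑ i ∈ hfin.toFinset, f i x * (f i x * S x) < ∑ i ∈ hfin.toFinset, f i x * Q x :=
      Finset.sum_lt_sum (fun j _ => mul_le_mul_of_nonneg_left (hcon j).le (h0 j x))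
        ⟨i, by simpa using hi.ne', mul_lt_mul_of_pos_left (hcon i) hi⟩
    rw [← Finset.sum_mul, ← hS'] at this
    simp only [← mul_assoc] at this
    rw [← Finset.sum_mul, ← hQ'] at this
    linarith
  -- This vanishes where the ratio `f i * S / Q` is at most `1/2` and equals `1` where it is at
  -- least `3/4`; at each point some ratio is at least `1`.
  let b : ι → C(X, ℝ) := fun i =>
    ⟨fun x => max 0 (min 1 (4 * (f i x * S x) / Q x - 2)), by
      have := fun x => (hQpos x).ne'
      have := (f i).continuous
      fun_prop (disch := assumption)⟩
  have hb : ∀ i x, b i x ≠ 0 → 2 * Q x ≤ 4 * (f i x * S x) := by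
    intro i x hx
    by_contra! hcon
    apply hx
    have : 4 * (f i x * S x) / Q x - 2 ≤ 0 := by
      rw [sub_nonpos, div_le_iff₀ (hQpos x)]; exact hcon.le
    exact max_eq_left ((min_le_right _ _).trans this)
  have hbf : ∀ i, tsupport (b i) ⊆ Function.support (f i) := by
    intro i
    have h1 : tsupport (b i) ⊆ {x | 2 * Q x ≤ 4 * (f i x * S x)} :=
      closure_minimal (fun x hx => hb i x hx)
        (isClosed_le (by fun_prop) (by have := (f i).continuous; fun_prop))
    intro x hx h
    have := h1 hx
    simp only [Set.mem_ofPred_eq, h] at this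
    linarith [hQpos x]
  let B : BumpCovering ι X Set.univ :=
    { toFun := b
      locallyFinite' := hf.subset fun i => subset_closure.trans (hbf i)
      nonneg' := fun i x => le_max_left _ _
      le_one' := fun i x => max_le zero_le_one (min_le_left _ _)
      eventuallyEq_one' := by
        intro x _
        obtain ⟨i, hi⟩ := hmax x
        refine ⟨i, ?_⟩
        have hopen : IsOpen {y | 3 * Q y < 4 * (f i y * S y)} :=
          isOpen_lt (by fun_prop) (by have := (f i).continuous; fun_prop)
        filter_upwards [hopen.mem_nhds (show 3 * Q x < _ by linarith [hQpos x])] with y hy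
        have : 1 ≤ 4 * (f i y * S y) / Q y - 2 := by
          rw [le_sub_iff_add_le, le_div_iff₀ (hQpos y)]
          linarith [show 3 * Q y < 4 * (f i y * S y) from hy]
        change max 0 (min 1 (4 * (f i y * S y) / Q y - 2)) = 1
        rw [min_eq_left this, max_eq_right zero_le_one] }
  exact ⟨B.toPartitionOfUnity, BumpCovering.IsSubordinate.toPartitionOfUnity
    fun i => (hbf i).trans (hU i)⟩

theorem isNumerableCover_of_support_subset {X ι : Type u} [TopologicalSpace X]
    {U : ι → Set X} (f : ι → C(X, ℝ)) (hf : LocallyFinite fun i => Function.support (f i))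
    (h0 : ∀ i x, 0 ≤ f i x) (hpos : ∀ x, ∃ i, 0 < f i x)
    (hU : ∀ i, Function.support (f i) ⊆ U i) : IsNumerableCover U := by
  refine ⟨Set.eq_univ_of_forall fun x => ?_,
    exists_partitionOfUnity_of_support_subset f hf h0 hpos hU⟩
  obtain ⟨i, hi⟩ := hpos x
  exact Set.mem_iUnion.2 ⟨i, hU i hi.ne'⟩

theorem exists_partitionOfUnity_nat {X : Type*} [TopologicalSpace X]
    (w : ℕ → C(X, ℝ)) (h0 : ∀ k x, 0 ≤ w k x) (hpos : ∀ x, ∃ k, 0 < w k x) :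
    ∃ p : PartitionOfUnity ℕ X Set.univ, p.IsSubordinate fun k => {x | 0 < w k x} := by
  classical
  -- The factor `k` forces local finiteness: where some `w i` is bounded below, the subtracted term
  -- exceeds `1` for all large `k`.
  let g : ℕ → C(X, ℝ) := fun k =>
    ⟨fun x => max 0 (min 1 (w k x) - k * ∑ i ∈ Finset.range k, w i x), by
      have := fun i => (w i).continuous
      fun_prop⟩
  have hsup : ∀ k, Function.support (g k) ⊆ {x | 0 < w k x} := by
    intro k x hx
    by_contra hcon
    refine hx (max_eq_left ?_)
    have h1 : 0 ≤ (k : ℝ) * ∑ i ∈ Finset.range k, w i x :=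
      mul_nonneg k.cast_nonneg (Finset.sum_nonneg fun i _ => h0 i x)
    have h2 := min_le_right 1 (w k x)
    have h3 : w k x ≤ 0 := not_lt.1 hcon
    linarith
  refine exists_partitionOfUnity_of_support_subset g ?_ (fun k x => le_max_left _ _) ?_ hsup
  · intro x
    obtain ⟨k, hk⟩ := hpos x
    -- On the neighbourhood `w k y > w k x / 2`, this makes `m * w k y ≥ 1` for all `m ≥ n`.
    obtain ⟨n, hn⟩ := exists_nat_gt (2 / w k x)
    refine ⟨{y | w k x / 2 < w k y},
      (isOpen_lt continuous_const (w k).continuous).mem_nhds (half_lt_self hk), ?_⟩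
    refine (Set.finite_lt_nat (max n (k + 1))).subset ?_
    rintro m ⟨y, hy, hy'⟩
    by_contra hm
    simp only [Set.mem_ofPred_eq, not_lt, max_le_iff] at hm hy'
    refine hy (max_eq_left ?_)
    have h1 : w k y ≤ ∑ i ∈ Finset.range m, w i y :=
      Finset.single_le_sum (f := fun i => w i y) (fun i _ => h0 i y)
        (Finset.mem_range.2 (by omega))
    have h2 : (n : ℝ) ≤ m := by exact_mod_cast hm.1
    have h3 : 1 ≤ (m : ℝ) * w k y := by
      rw [div_lt_iff₀ hk] at hn
      have : (n : ℝ) * w k x ≤ m * w k x := mul_le_mul_of_nonneg_right h2 hk.le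
      have : (m : ℝ) * (w k x / 2) ≤ m * w k y :=
        mul_le_mul_of_nonneg_left hy'.le m.cast_nonneg
      linarith
    have h4 := mul_le_mul_of_nonneg_left h1 (m.cast_nonneg (α := ℝ))
    linarith [min_le_left 1 (w m y)]
  · intro x
    have hex := hpos x
    refine ⟨Nat.find hex, ?_⟩
    have hz : ∑ i ∈ Finset.range (Nat.find hex), w i x = 0 :=
      Finset.sum_eq_zero fun i hi => le_antisymm
        (not_lt.1 (Nat.find_min hex (Finset.mem_range.1 hi))) (h0 i x)
    change 0 < max 0 _
    rw [hz, mul_zero, sub_zero]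
    exact lt_max_of_lt_right (lt_min one_pos (Nat.find_spec hex))

end Numerations

/-! ### Gluing Dold spaces -/

section DoldSpaces

theorem isDoldSpace_sigma {ι : Type u} {Z : ι → Type u} [∀ i, TopologicalSpace (Z i)]
    (h : ∀ i, IsDoldSpace (Z i)) : IsDoldSpace (Σ i, Z i) := by
  classical
  choose A U hU using h
  choose p hp using fun i => (hU i).1.2
  let e : ∀ i, C(Z i, Σ i, Z i) := fun i => ⟨Sigma.mk i, continuous_sigmaMk⟩
  let f : (Σ i, A i) → C((Σ i, Z i), ℝ) := fun a =>
    ⟨fun z => if h : z.1 = a.1 then p a.1 a.2 (h ▸ z.2) else 0, by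
      refine continuous_sigma fun i => ?_
      by_cases hi : i = a.1
      · subst hi
        simpa using (p a.1 a.2).continuous
      · simpa [hi] using continuous_const⟩
  have hf : ∀ i a (z : Z i), f ⟨i, a⟩ ⟨i, z⟩ = p i a z := fun i a z => by simp [f]
  have hf' : ∀ i j a (z : Z j), f ⟨i, a⟩ ⟨j, z⟩ ≠ 0 → i = j := fun i j a z hz => by
    by_contra hij
    exact hz (dif_neg (Ne.symm hij))
  refine ⟨Σ i, A i, fun a => Sigma.mk a.1 '' U a.1 a.2,
    isNumerableCover_of_support_subset f ?_ ?_ ?_ ?_, ?_⟩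
  · rintro ⟨i, z⟩
    obtain ⟨t, ht, hfin⟩ := (p i).locallyFinite z
    refine ⟨Sigma.mk i '' t, (isOpenMap_sigmaMk).image_mem_nhds ht,
      (hfin.image (Sigma.mk i)).subset ?_⟩
    rintro ⟨j, a⟩ ⟨_, hy, ⟨y, hyt, rfl⟩⟩
    obtain rfl := hf' _ _ _ _ hy
    exact ⟨a, ⟨y, by simpa [hf] using hy, hyt⟩, rfl⟩
  · rintro ⟨i, a⟩ ⟨j, z⟩
    by_cases hij : i = j
    · subst hij
      rw [hf]; exact (p i).nonneg a z
    · by_contra hcon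
      exact hij (hf' _ _ _ _ (not_le.1 hcon).ne)
  · rintro ⟨i, z⟩
    obtain ⟨a, ha⟩ := (p i).exists_pos (Set.mem_univ z)
    exact ⟨⟨i, a⟩, by rwa [hf]⟩
  · rintro ⟨i, a⟩ ⟨j, z⟩ hz
    obtain rfl := hf' _ _ _ _ hz
    refine ⟨z, hp i a (subset_closure ?_), rfl⟩
    simpa [hf] using hz
  · rintro ⟨i, a⟩
    let r : C(Sigma.mk i '' U i a, U i a) :=
      ⟨fun z => ⟨(Equiv.Set.image _ (U i a) sigma_mk_injective).symm z, Subtype.coe_prop _⟩, by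
        refine Continuous.subtype_mk ?_ _
        have hemb := (Topology.IsEmbedding.sigmaMk (σ := Z) (i := i))
        rw [hemb.continuous_iff]
        convert continuous_subtype_val using 1
        ext1 z
        obtain ⟨_, z, hz, rfl⟩ := z
        exact congrArg (fun w : U i a => Sigma.mk i w.1)
          (Equiv.Set.image_symm_apply (Sigma.mk i) (U i a) sigma_mk_injective z _)⟩
    have h1 := ((hU i).2 a).comp_right (e i)
    have h2 := h1.comp_left r
    have : ((e i).comp (incl (U i a))).comp r = incl (Sigma.mk i '' U i a) := by
      ext1 z
      obtain ⟨_, z, hz, rfl⟩ := z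
      exact congrArg (fun w : U i a => Sigma.mk i w.1)
        (Equiv.Set.image_symm_apply (Sigma.mk i) (U i a) sigma_mk_injective z _)
    rw [this] at h2
    exact h2

/-- On the preimage of `U i a` under `c i`, the inclusion is homotopic to a map that factors through
the nullhomotopic inclusion of `U i a`. Products of the two partitions of unity numerate these
preimages. -/
theorem isDoldSpace_of_partitionOfUnity {X : Type u} {ι : Type} [TopologicalSpace X]
    {W : ι → Set X} (hW : ∀ i, IsOpen (W i)) (p : PartitionOfUnity ι X Set.univ)
    (hp : p.IsSubordinate W) {Z : ι → Type u} [∀ i, TopologicalSpace (Z i)]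
    (hZ : ∀ i, IsDoldSpace (Z i)) (c : ∀ i, C(W i, Z i)) (e : ∀ i, C(Z i, X))
    (h : ∀ i, (incl (W i)).Homotopic ((e i).comp (c i))) : IsDoldSpace X := by
  classical
  choose A U hU using hZ
  choose q hq using fun i => (hU i).1.2
  let F : (Σ i, A i) → X → ℝ := fun a x =>
    if hx : x ∈ W a.1 then p a.1 x * q a.1 a.2 (c a.1 ⟨x, hx⟩) else 0
  -- Extension by zero is continuous because the closed support of `p i` lies in the open set `W i`.
  have hF : ∀ a, Continuous (F a) := by
    rintro ⟨i, a⟩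
    rw [continuous_iff_continuousAt]
    intro x
    by_cases hx : x ∈ tsupport (p i)
    · have hxW := hp i hx
      have : ContinuousOn (F ⟨i, a⟩) (W i) := by
        rw [continuousOn_iff_continuous_domRestrict]
        have : (W i).domRestrict (F ⟨i, a⟩) = fun y : W i => p i y * q i a (c i y) := by
          ext1 y; exact dif_pos y.2
        rw [this]
        have := (p i).continuous; have := (q i a).continuous; have := (c i).continuous
        fun_prop
      exact this.continuousAt ((hW i).mem_nhds hxW)
    · have : F ⟨i, a⟩ =ᶠ[nhds x] fun _ => 0 := by
        filter_upwards [(isClosed_tsupport _).isOpen_compl.mem_nhds hx] with y hy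
        have : p i y = 0 := image_eq_zero_of_notMem_tsupport hy
        simp [F, this]
      exact (continuousAt_const).congr this.symm
  refine ⟨Σ i, A i, fun a => {x | ∃ hx : x ∈ W a.1, c a.1 ⟨x, hx⟩ ∈ U a.1 a.2},
    isNumerableCover_of_support_subset (fun a => ⟨F a, hF a⟩) ?_ ?_ ?_ ?_, ?_⟩
  · intro x
    obtain ⟨t, ht, hfin⟩ := p.locallyFinite_tsupport x
    have hloc : ∀ i, ∃ s ∈ nhds x,
        {a | ((Function.support (F ⟨i, a⟩)) ∩ s).Nonempty}.Finite := by
      intro i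
      by_cases hx : x ∈ tsupport (p i)
      · obtain ⟨s, hs, hsf⟩ := (q i).locallyFinite (c i ⟨x, hp i hx⟩)
        have h1 := (c i).continuous.continuousAt hs
        refine ⟨Subtype.val '' ((c i) ⁻¹' s),
          (hW i).isOpenMap_subtype_val.image_mem_nhds (x := ⟨x, hp i hx⟩) h1, hsf.subset ?_⟩
        rintro a ⟨_, hy, ⟨y, hys, rfl⟩⟩
        refine ⟨c i y, ?_, hys⟩
        simp only [Function.mem_support, F, Subtype.coe_prop, dite_true] at hy
        exact right_ne_zero_of_mul hy
      · refine ⟨_, (isClosed_tsupport _).isOpen_compl.mem_nhds hx, ?_⟩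
        convert Set.finite_empty
        refine Set.eq_empty_of_forall_notMem ?_
        rintro a ⟨y, hy, hyn⟩
        have : p i y = 0 := image_eq_zero_of_notMem_tsupport hyn
        simp [F, this] at hy
    choose s hs hsf using hloc
    refine ⟨t ∩ ⋂ i ∈ hfin.toFinset, s i,
      Filter.inter_mem ht ((Filter.biInter_finset_mem _).2 fun i _ => hs i), ?_⟩
    refine (Set.Finite.biUnion hfin fun i _ => (hsf i).image (Sigma.mk i)).subset ?_
    rintro ⟨i, a⟩ ⟨y, hy, hyt, hys⟩
    have hpy : p i y ≠ 0 := by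
      intro h0
      simp [F, h0] at hy
    have hi : (tsupport (p i) ∩ t).Nonempty := ⟨y, subset_closure hpy, hyt⟩
    refine Set.mem_biUnion hi ⟨a, ⟨y, hy, ?_⟩, rfl⟩
    exact Set.mem_iInter₂.1 hys i (by simpa using hi)
  · rintro ⟨i, a⟩ x
    change 0 ≤ F _ x
    by_cases hx : x ∈ W i
    · simp only [F, hx, dite_true]
      exact mul_nonneg (p.nonneg i x) ((q i).nonneg a _)
    · simp [F, hx]
  · intro x
    obtain ⟨i, hi⟩ := p.exists_pos (Set.mem_univ x)
    have hx : x ∈ W i := hp i (subset_closure hi.ne')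
    obtain ⟨a, ha⟩ := (q i).exists_pos (Set.mem_univ (c i ⟨x, hx⟩))
    refine ⟨⟨i, a⟩, ?_⟩
    change 0 < F _ x
    simp only [F, hx, dite_true]
    exact mul_pos hi ha
  · rintro ⟨i, a⟩ x (hx : F _ x ≠ 0)
    by_cases hxW : x ∈ W i
    · refine ⟨hxW, hq i a (subset_closure ?_)⟩
      simp only [F, hxW, dite_true] at hx
      exact right_ne_zero_of_mul hx
    · simp [F, hxW] at hx
  · rintro ⟨i, a⟩
    let V : Set X := {x | ∃ hx : x ∈ W i, c i ⟨x, hx⟩ ∈ U i a}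
    let j : C(V, W i) := ⟨fun x => ⟨x.1, x.2.1⟩, by fun_prop⟩
    let d : C(V, U i a) := ⟨fun x => ⟨c i ⟨x.1, x.2.1⟩, x.2.2⟩, by fun_prop⟩
    have h1 : (incl V).Homotopic (((e i).comp (c i)).comp j) := (h i).comp (.refl j)
    obtain ⟨y, hy⟩ := (((hU i).2 a).comp_right (e i)).comp_left d
    exact ⟨y, h1.trans hy⟩

end DoldSpaces

/-! ### Contractible neighbourhoods of base points -/

section Wellpointed

/-- A wellpointed space has a numerable neighbourhood of the base point that is ambiently
contractible. -/
theorem HasHomotopyExtension.exists_halo {Y : Type u} [TopologicalSpace Y] {y₀ : Y}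
    (h : HasHomotopyExtension (incl ({y₀} : Set Y))) :
    ∃ v : C(Y, ℝ), v y₀ = 1 ∧ (∀ y, 0 ≤ v y) ∧ IsAmbientlyContractible {y | 0 < v y} := by
  -- `Q` is `Y` with a whisker `{y₀} × [0, 1]`. Extend the homotopy that runs up the whisker; a
  -- point whose final height is positive has ended on the whisker, so its `Y`-coordinate has moved
  -- to `y₀`.
  let Q : Type u := {p : Y × unitInterval // p.2 = 0 ∨ p.1 = y₀}
  let f : C(Y, Q) := ⟨fun y => ⟨(y, 0), Or.inl rfl⟩, by fun_prop⟩
  let γ : C(({y₀} : Set Y) × unitInterval, Q) := ⟨fun p => ⟨(y₀, p.2), Or.inr rfl⟩, by fun_prop⟩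
  obtain ⟨H, H0, H1⟩ := h Q f γ fun a => by
    obtain ⟨_, rfl⟩ := a
    rfl
  refine ⟨⟨fun y => ((H (y, 1)).1.2 : ℝ), continuous_subtype_val.comp (continuous_snd.comp
    (continuous_subtype_val.comp (H.continuous.comp (by fun_prop))))⟩, ?_, fun y => ?_, y₀, ⟨?_⟩⟩
  · have := H1 ⟨y₀, rfl⟩ 1
    change ((H (y₀, 1)).1.2 : ℝ) = 1
    change H (y₀, 1) = _ at this
    rw [this]
    rfl
  · exact (H (y, 1)).1.2.2.1
  · refine ⟨⟨fun p => (H (p.2.1, p.1)).1.1, continuous_fst.comp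
      (continuous_subtype_val.comp (H.continuous.comp (by fun_prop)))⟩, fun y => ?_, fun y => ?_⟩
    · change (H (y.1, 0)).1.1 = y.1
      rw [H0]
      rfl
    · change (H (y.1, 1)).1.1 = y₀
      refine (H (y.1, 1)).2.resolve_left fun h0 => ?_
      have : 0 < ((H (y.1, 1)).1.2 : ℝ) := y.2
      rw [h0] at this
      exact lt_irrefl _ this

end Wellpointed

/-! ### Quotients by the image of a map -/

section CollapseSpaces

variable {A X : Type u} [TopologicalSpace A] [TopologicalSpace X] (i : C(A, X))

/-- The quotient map `X → X / A`. -/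
def Collapse.proj : C(X, Collapse i) :=
  ⟨fun x => Quot.mk _ (Sum.inl x), continuous_quot_mk.comp continuous_inl⟩

theorem Collapse.proj_apply (a : A) : Collapse.proj i (i a) = Collapse.pt i :=
  Quot.sound (CollapseRel.glue a)

theorem Collapse.proj_eq_pt_iff (x : X) : Collapse.proj i x = Collapse.pt i ↔ x ∈ Set.range i := by
  refine ⟨fun h => ?_, ?_⟩
  · let P : Collapse i → Prop := Quot.lift (Sum.elim (· ∈ Set.range i) fun _ => True) (by
      rintro _ _ ⟨a⟩
      simp)
    have : P (Collapse.proj i x) = P (Collapse.pt i) := congrArg P h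
    exact this.mpr trivial
  · rintro ⟨a, rfl⟩
    exact Collapse.proj_apply i a

theorem Collapse.proj_injOn {x y : X} (hx : x ∉ Set.range i)
    (h : Collapse.proj i y = Collapse.proj i x) : y = x := by
  let P : Collapse i → Prop := Quot.lift (Sum.elim (· = x) fun _ => False) (by
    rintro _ _ ⟨a⟩
    simp only [Sum.elim_inl, Sum.elim_inr, eq_iff_iff, iff_false]
    rintro rfl
    exact hx ⟨a, rfl⟩)
  have : P (Collapse.proj i y) = P (Collapse.proj i x) := congrArg P h
  exact this.mpr rfl

theorem Collapse.cases (y : Collapse i) : y = Collapse.pt i ∨ ∃ x, Collapse.proj i x = y := by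
  obtain ⟨x | x, rfl⟩ := Quot.exists_rep y
  · exact Or.inr ⟨x, rfl⟩
  · exact Or.inl rfl

theorem Collapse.isClosed_pt (h : IsClosed (Set.range i)) : IsClosed ({Collapse.pt i} : Set _) := by
  refine isQuotientMap_quot_mk.isClosed_preimage.1 (isClosed_sum_iff.2 ⟨?_, ?_⟩)
  · convert h
    ext x
    exact Collapse.proj_eq_pt_iff i x
  · convert isClosed_univ
    ext x
    exact iff_of_true rfl trivial

theorem Collapse.isOpen_image {G : Set X} (hG : IsOpen G) (h : ∀ x ∈ G, x ∉ Set.range i) :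
    IsOpen (Collapse.proj i '' G) := by
  refine isQuotientMap_quot_mk.isOpen_preimage.1 (isOpen_sum_iff.2 ⟨?_, ?_⟩)
  · convert hG
    ext x
    constructor
    · rintro ⟨y, hy, hyx⟩
      rwa [Collapse.proj_injOn i (h y hy) hyx.symm]
    · exact fun hx => ⟨x, hx, rfl⟩
  · convert isOpen_empty
    refine Set.eq_empty_of_forall_notMem ?_
    rintro _ ⟨y, hy, hyx⟩
    exact h y hy ((Collapse.proj_eq_pt_iff i y).1 hyx)

/-- The halo `v` of the base point supplies one contractible set; the others are images of the `U a`
with the image of `i` removed. The cutoff `max 0 (1 / 2 - v)` lets their numeration descend to the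
quotient and vanish near the base point, which gives local finiteness there. -/
theorem Collapse.isDoldSpace (hX : IsDoldSpace X)
    (hw : IsWellpointed (Collapse i) (Collapse.pt i)) : IsDoldSpace (Collapse i) := by
  classical
  obtain ⟨ι, U, hU⟩ := hX
  obtain ⟨p, hp⟩ := hU.1.2
  obtain ⟨v, v1, v0, hv⟩ := hw.2.exists_halo
  have hclosed : IsClosed (Set.range i) := by
    convert hw.1.preimage (Collapse.proj i).continuous
    ext x
    exact (Collapse.proj_eq_pt_iff i x).symm
  let q := Collapse.proj i
  let f : Option ι → C(Collapse i, ℝ) := fun o => o.elim v fun a =>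
    ⟨Quot.lift (Sum.elim (fun x => p a x * max 0 (1 / 2 - v (q x))) fun _ => 0) (by
      rintro _ _ ⟨b⟩
      simp only [Sum.elim_inl, Sum.elim_inr, q, Collapse.proj_apply, v1]
      norm_num), continuous_quot_lift _ (by
        have := (p a).continuous
        exact Continuous.sumElim (by fun_prop) continuous_const)⟩
  have f1 : ∀ a x, f (some a) (q x) = p a x * max 0 (1 / 2 - v (q x)) := fun a x => rfl
  have f2 : ∀ a, f (some a) (Collapse.pt i) = 0 := fun a => rfl
  let V : Option ι → Set (Collapse i) := fun o => o.elim {y | 0 < v y} fun a =>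
    q '' (U a ∩ (Set.range i)ᶜ)
  have hpos : ∀ o y, 0 ≤ f o y := by
    rintro (_ | a) y
    · exact v0 y
    · rcases Collapse.cases i y with rfl | ⟨x, rfl⟩
      · exact (f2 a).ge
      · exact mul_nonneg (p.nonneg a x) (le_max_left _ _)
  have hnon : ∀ a y, f (some a) y ≠ 0 → v y < 1 / 2 := by
    intro a y hy
    rcases Collapse.cases i y with rfl | ⟨x, rfl⟩
    · exact absurd (f2 a) hy
    · by_contra hcon
      refine hy (?_ : p a x * max 0 (1 / 2 - v (q x)) = 0)
      rw [max_eq_left (by linarith [not_lt.1 hcon]), mul_zero]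
  refine ⟨Option ι, V, isNumerableCover_of_support_subset f ?_ hpos ?_ ?_, ?_⟩
  · intro y
    by_cases hy : y = Collapse.pt i
    · refine ⟨{y | 1 / 2 < v y}, (isOpen_lt continuous_const v.continuous).mem_nhds ?_,
        (Set.finite_singleton none).subset ?_⟩
      · simp only [Set.mem_ofPred_eq, hy, v1]; norm_num
      · rintro (_ | a) ⟨z, hz, hz'⟩
        · rfl
        · exact absurd (hnon a z hz) (lt_asymm hz')
    · obtain ⟨x, rfl⟩ := (Collapse.cases i y).resolve_left hy
      obtain ⟨t, ht, hfin⟩ := p.locallyFinite x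
      obtain ⟨t', ht't, ht', hxt'⟩ := mem_nhds_iff.1 ht
      refine ⟨q '' (t' ∩ (Set.range i)ᶜ),
        (Collapse.isOpen_image i (ht'.inter hclosed.isOpen_compl) fun x hx => hx.2).mem_nhds
          ⟨x, ⟨hxt', fun hx => hy ((Collapse.proj_eq_pt_iff i x).2 hx)⟩, rfl⟩,
        ((hfin.image some).union (Set.finite_singleton none)).subset ?_⟩
      rintro (_ | a) ⟨_, hz, ⟨z, hz', rfl⟩⟩
      · exact Or.inr rfl
      · exact Or.inl ⟨a, ⟨z, left_ne_zero_of_mul ((f1 a z).symm.trans_ne hz), ht't hz'.1⟩, rfl⟩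
  · intro y
    rcases (v0 y).eq_or_lt with h0 | h0
    · obtain ⟨x, rfl⟩ := (Collapse.cases i y).resolve_left (by rintro rfl; linarith)
      obtain ⟨a, ha⟩ := p.exists_pos (Set.mem_univ x)
      refine ⟨some a, ?_⟩
      change 0 < p a x * max 0 (1 / 2 - v (q x))
      rw [← h0]
      exact mul_pos ha (by norm_num)
    · exact ⟨none, h0⟩
  · rintro (_ | a) y hy
    · exact lt_of_le_of_ne (v0 y) (Ne.symm hy)
    · have h2 := hnon a y hy
      have hne : y ≠ Collapse.pt i := by rintro rfl; linarith
      obtain ⟨x, rfl⟩ := (Collapse.cases i y).resolve_left hne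
      exact ⟨x, ⟨hp a (subset_closure (left_ne_zero_of_mul ((f1 a x).symm.trans_ne hy))),
        fun hx => hne ((Collapse.proj_eq_pt_iff i x).2 hx)⟩, rfl⟩
  · rintro (_ | a)
    · exact hv
    -- Off the image of `i` the projection is injective and open, so this section is continuous.
    · choose s hs hs' using fun y : q '' (U a ∩ (Set.range i)ᶜ) => y.2
      have hsc : Continuous s := by
        rw [continuous_def]
        intro G hG
        have h1 := Collapse.isOpen_image i (hG.inter hclosed.isOpen_compl) fun x hx => hx.2
        convert h1.preimage continuous_subtype_val
        ext y
        constructor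
        · exact fun hy => ⟨s y, ⟨hy, (hs y).2⟩, hs' y⟩
        · rintro ⟨x, hx, hxy⟩
          have : s y = x := Collapse.proj_injOn i hx.2 ((hs' y).trans hxy.symm)
          exact (congrArg (· ∈ G) this).mpr hx.1
      have h1 := ((hU.2 a).comp_right q).comp_left
        (⟨fun y => ⟨s y, (hs y).1⟩, by fun_prop⟩ : C(V (some a), U a))
      have h2 : (q.comp (incl (U a))).comp
          (⟨fun y => ⟨s y, (hs y).1⟩, by fun_prop⟩ : C(V (some a), U a)) = incl (V (some a)) :=
        ContinuousMap.ext hs'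
      rwa [h2] at h1

end CollapseSpaces

/-! ### Chains of morphisms and identities in them -/

section Chains

variable {J : Type u} [SmallCategory J]

/-- The restriction of a chain along a monotone map. -/
abbrev pull {m n : ℕ} (θ : Fin (m + 1) →o Fin (n + 1)) (σ : ComposableArrows J n) :
    ComposableArrows J m :=
  (nerve J).map (SimplexCategory.mkHom θ).op σ

/-- The morphism of a chain between two of its objects, as an element of the type of all
morphisms. -/
def arr {n : ℕ} (σ : ComposableArrows J n) {i j : Fin (n + 1)} (h : i ≤ j) : Σ a b : J, (a ⟶ b) :=
  ⟨σ.obj i, σ.obj j, σ.map (homOfLE h)⟩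

/-- The morphism is an identity. -/
def IsIdent (f : Σ a b : J, (a ⟶ b)) : Prop := ∃ a, f = ⟨a, a, 𝟙 a⟩

theorem arr_pull {m n : ℕ} (θ : Fin (m + 1) →o Fin (n + 1)) (σ : ComposableArrows J n)
    {i j : Fin (m + 1)} (h : i ≤ j) : arr (pull θ σ) h = arr σ (θ.monotone h) := rfl

theorem isIdent_arr_refl {n : ℕ} (σ : ComposableArrows J n) (i : Fin (n + 1)) :
    IsIdent (arr σ (le_refl i)) :=
  ⟨σ.obj i, by unfold arr; rw [show homOfLE (le_refl i) = 𝟙 i from rfl, σ.map_id]⟩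

theorem sigma_comp_of_isIdent_left {a b c : J} (f : a ⟶ b) (g : b ⟶ c)
    (h : IsIdent (⟨a, b, f⟩ : Σ a b : J, (a ⟶ b))) :
    (⟨a, c, f ≫ g⟩ : Σ a b : J, (a ⟶ b)) = ⟨b, c, g⟩ := by
  obtain ⟨d, hd⟩ := h
  cases hd
  rw [Category.id_comp]

theorem sigma_comp_of_isIdent_right {a b c : J} (f : a ⟶ b) (g : b ⟶ c)
    (h : IsIdent (⟨b, c, g⟩ : Σ a b : J, (a ⟶ b))) :
    (⟨a, c, f ≫ g⟩ : Σ a b : J, (a ⟶ b)) = ⟨a, b, f⟩ := by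
  obtain ⟨d, hd⟩ := h
  cases hd
  rw [Category.comp_id]

theorem arr_comp {n : ℕ} (σ : ComposableArrows J n) {i j k : Fin (n + 1)} (hij : i ≤ j)
    (hjk : j ≤ k) : arr σ (hij.trans hjk) =
      ⟨σ.obj i, σ.obj k, σ.map (homOfLE hij) ≫ σ.map (homOfLE hjk)⟩ := by
  rw [← σ.map_comp]; rfl

theorem arr_trans_eq_right {n : ℕ} {σ : ComposableArrows J n} {i j k : Fin (n + 1)} {hij : i ≤ j}
    (h : IsIdent (arr σ hij)) (hjk : j ≤ k) : arr σ (hij.trans hjk) = arr σ hjk :=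
  (arr_comp σ hij hjk).trans (sigma_comp_of_isIdent_left _ _ h)

theorem arr_trans_eq_left {n : ℕ} {σ : ComposableArrows J n} {i j k : Fin (n + 1)} {hjk : j ≤ k}
    (h : IsIdent (arr σ hjk)) (hij : i ≤ j) : arr σ (hij.trans hjk) = arr σ hij :=
  (arr_comp σ hij hjk).trans (sigma_comp_of_isIdent_right _ _ h)

/-- The morphism of a chain between the `i`-th and the `j`-th object is an identity. -/
def Linked {n : ℕ} (σ : ComposableArrows J n) (i j : Fin (n + 1)) : Prop :=
  (∃ h : i ≤ j, IsIdent (arr σ h)) ∨ ∃ h : j ≤ i, IsIdent (arr σ h)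

variable {n : ℕ} {σ : ComposableArrows J n}

theorem Linked.refl (i : Fin (n + 1)) : Linked σ i i := Or.inl ⟨le_rfl, isIdent_arr_refl σ i⟩

theorem Linked.symm {i j : Fin (n + 1)} (h : Linked σ i j) : Linked σ j i := Or.symm h

theorem Linked.isIdent {i j : Fin (n + 1)} (h : Linked σ i j) (hij : i ≤ j) :
    IsIdent (arr σ hij) := by
  rcases h with ⟨_, h⟩ | ⟨h', h⟩
  · exact h
  · obtain rfl := le_antisymm hij h'
    exact h

theorem arr_eq_of_linked_right {i j j' : Fin (n + 1)} (h : Linked σ j j') (hj : i ≤ j)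
    (hj' : i ≤ j') : arr σ hj = arr σ hj' := by
  rcases h with ⟨hle, h⟩ | ⟨hle, h⟩
  · exact (arr_trans_eq_left h hj).symm
  · exact arr_trans_eq_left h hj'

theorem arr_eq_of_linked_left {i i' j : Fin (n + 1)} (h : Linked σ i i') (hi : i ≤ j)
    (hi' : i' ≤ j) : arr σ hi = arr σ hi' := by
  rcases h with ⟨hle, h⟩ | ⟨hle, h⟩
  · exact arr_trans_eq_right h hi'
  · exact (arr_trans_eq_right h hi).symm

/-- Change one end at a time; comparing `j` with `j'` decides which end goes first, so that the
intermediate morphism points forward. -/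
theorem arr_eq_of_linked {i i' j j' : Fin (n + 1)} (hi : Linked σ i i') (hj : Linked σ j j')
    (h : i ≤ j) (h' : i' ≤ j') : arr σ h = arr σ h' := by
  rcases le_total j j' with hle | hle
  · exact (arr_eq_of_linked_right hj h (h.trans hle)).trans
      (arr_eq_of_linked_left hi (h.trans hle) h')
  · exact (arr_eq_of_linked_left hi h (h'.trans hle)).trans
      (arr_eq_of_linked_right hj (h'.trans hle) h')

/-- By `arr_eq_of_linked` the morphism between `i` and `k` equals that from `j` to itself, whatever
the order of the three. Linked classes need not be intervals, since an identity may factor through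
another object. -/
theorem Linked.trans {i j k : Fin (n + 1)} (hij : Linked σ i j) (hjk : Linked σ j k) :
    Linked σ i k := by
  rcases le_total i k with h | h
  · exact Or.inl ⟨h, arr_eq_of_linked hij hjk.symm h (le_refl j) ▸ isIdent_arr_refl σ j⟩
  · exact Or.inr ⟨h, arr_eq_of_linked hjk.symm hij h (le_refl j) ▸ isIdent_arr_refl σ j⟩

theorem linked_pull {m : ℕ} (θ : Fin (m + 1) →o Fin (n + 1)) {i j : Fin (m + 1)} :
    Linked (pull θ σ) i j ↔ Linked σ (θ i) (θ j) := by
  refine ⟨?_, fun h => ?_⟩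
  · rintro (⟨h, h'⟩ | ⟨h, h'⟩)
    · exact Or.inl ⟨θ.monotone h, h'⟩
    · exact Or.inr ⟨θ.monotone h, h'⟩
  · rcases le_total i j with hij | hij
    · exact Or.inl ⟨hij, h.isIdent (θ.monotone hij)⟩
    · exact Or.inr ⟨hij, h.symm.isIdent (θ.monotone hij)⟩

theorem chain_ext {σ τ : ComposableArrows J n} (h : ∀ i j (hij : i ≤ j), arr σ hij = arr τ hij) :
    σ = τ := by
  have h1 : ∀ {a b a' b' : J} {f : a ⟶ b} {g : a' ⟶ b'},
      (⟨a, b, f⟩ : Σ a b : J, (a ⟶ b)) = ⟨a', b', g⟩ → a = a' ∧ HEq f g := by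
    intro a b a' b' f g h
    cases h
    exact ⟨rfl, HEq.rfl⟩
  exact Functor.hext (fun i => (h1 (h i i le_rfl)).1) fun i j f => (h1 (h i j (leOfHom f))).2

variable {D : J ⥤ TopCat.{u}}

/-- The image of a point of the first space of a chain in the `i`-th space. -/
def push (σ : ComposableArrows J n) (i : Fin (n + 1)) (x : D.obj (σ.obj 0)) : D.obj (σ.obj i) :=
  D.map (σ.map (homOfLE (Fin.zero_le i))) x

/-- The image of a point of the first space of a chain in the `i`-th space, as an element of the
disjoint union of all spaces of the diagram. -/
def trace (σ : ComposableArrows J n) (i : Fin (n + 1)) (x : D.obj (σ.obj 0)) : Σ j, D.obj j :=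
  ⟨σ.obj i, push σ i x⟩

theorem push_zero (x : D.obj (σ.obj 0)) : push σ 0 x = x :=
  ConcreteCategory.congr_hom ((congrArg D.map (σ.map_id 0)).trans (D.map_id _)) x

theorem continuous_push (i : Fin (n + 1)) :
    Continuous (fun x : D.obj (σ.obj 0) => push σ i x) :=
  (D.map (σ.map (homOfLE (Fin.zero_le i)))).hom.continuous

theorem continuous_trace (i : Fin (n + 1)) :
    Continuous (fun x : D.obj (σ.obj 0) => trace σ i x) :=
  continuous_sigmaMk.comp (continuous_push i)

theorem map_push {i j : Fin (n + 1)} (h : i ≤ j) (x : D.obj (σ.obj 0)) :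
    D.map (σ.map (homOfLE h)) (push σ i x) = push σ j x := by
  have : σ.map (homOfLE (Fin.zero_le j)) =
      σ.map (homOfLE (Fin.zero_le i)) ≫ σ.map (homOfLE h) := by
    rw [← σ.map_comp]; rfl
  exact (ConcreteCategory.congr_hom ((congrArg D.map this).trans (D.map_comp _ _)) x).symm

theorem push_pull {m : ℕ} (θ : Fin (m + 1) →o Fin (n + 1)) (i : Fin (m + 1))
    (x : D.obj (σ.obj 0)) : push (pull θ σ) i (push σ (θ 0) x) = push σ (θ i) x :=
  map_push (θ.monotone (Fin.zero_le i)) x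

theorem trace_pull {m : ℕ} (θ : Fin (m + 1) →o Fin (n + 1)) (i : Fin (m + 1))
    (x : D.obj (σ.obj 0)) : trace (pull θ σ) i (push σ (θ 0) x) = trace σ (θ i) x :=
  congrArg (Sigma.mk (β := fun j => D.obj j) (σ.obj (θ i))) (push_pull θ i x)

theorem Linked.trace_eq {i j : Fin (n + 1)} (h : Linked σ i j) (x : D.obj (σ.obj 0)) :
    trace σ i x = trace σ j x := by
  have key : ∀ {a b : J} (f : a ⟶ b) (y : D.obj a), IsIdent ⟨a, b, f⟩ →
      (⟨a, y⟩ : Σ j, D.obj j) = ⟨b, D.map f y⟩ := by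
    rintro a b f y ⟨c, hc⟩
    cases hc
    rw [D.map_id]
    rfl
  rcases h with ⟨hij, h⟩ | ⟨hij, h⟩
  · exact (key _ (push σ i x) h).trans (by rw [map_push hij]; rfl)
  · exact ((key _ (push σ j x) h).trans (by rw [map_push hij]; rfl)).symm

theorem sigma_chain_ext {σ τ : ComposableArrows J n} {x : D.obj (σ.obj 0)} {y : D.obj (τ.obj 0)}
    (h : ∀ i j (hij : i ≤ j), arr σ hij = arr τ hij) (h0 : trace σ 0 x = trace τ 0 y) :
    (⟨σ, x⟩ : ReplacementSpace D n) = ⟨τ, y⟩ := by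
  obtain rfl := chain_ext h
  congr 1
  rw [trace, trace, push_zero, push_zero] at h0
  exact eq_of_heq (Sigma.mk.inj h0).2

end Chains

/-! ### The cells of the homotopy colimit -/

section Cells

variable {J : Type u} [SmallCategory J] {D : J ⥤ TopCat.{u}}

/-- The standard topological `n`-simplex. -/
abbrev Simplex (n : ℕ) : Type := stdSimplex ℝ (Fin (n + 1))

/-- The map from `D (j₀) × Δⁿ` to the homotopy colimit for a chain `j₀ ⟶ ⋯ ⟶ jₙ`. -/
def cell {n : ℕ} (σ : ComposableArrows J n) (x : D.obj (σ.obj 0)) (t : Simplex n) : Hocolim D :=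
  Quot.mk _ ⟨SimplexCategory.mk n, ⟨σ, x⟩, t⟩

theorem cell_pull {m n : ℕ} (θ : Fin (m + 1) →o Fin (n + 1)) (σ : ComposableArrows J n)
    (x : D.obj (σ.obj 0)) (t : Simplex m) :
    cell (pull θ σ) (push σ (θ 0) x) t = cell σ x (stdSimplex.map θ t) :=
  Quot.sound (RealizationRel.glue (X := simplicialReplacement D) (SimplexCategory.mkHom θ)
    (⟨σ, x⟩ : ReplacementSpace D n) t)

theorem cell_congr {n : ℕ} {σ τ : ComposableArrows J n} {x : D.obj (σ.obj 0)}
    {y : D.obj (τ.obj 0)} (h : (⟨σ, x⟩ : ReplacementSpace D n) = ⟨τ, y⟩) (t : Simplex n) :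
    cell σ x t = cell τ y t :=
  congrArg (fun z : ReplacementSpace D n => cell z.1 z.2 t) h

theorem exists_cell (p : Hocolim D) : ∃ (n : ℕ) (σ : ComposableArrows J n) (x : D.obj (σ.obj 0))
    (t : Simplex n), cell σ x t = p := by
  obtain ⟨⟨n, ⟨σ, x⟩, t⟩, rfl⟩ := Quot.exists_rep p
  exact ⟨n.len, σ, x, t, rfl⟩

/-- Functions on the homotopy colimit are compatible families of functions on the cells. -/
def Hocolim.lift {β : Sort*}
    (φ : ∀ {n : ℕ} (σ : ComposableArrows J n), D.obj (σ.obj 0) → Simplex n → β)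
    (h : ∀ {m n : ℕ} (θ : Fin (m + 1) →o Fin (n + 1)) (σ : ComposableArrows J n)
      (x : D.obj (σ.obj 0)) (t : Simplex m),
      φ (pull θ σ) (push σ (θ 0) x) t = φ σ x (stdSimplex.map θ t)) : Hocolim D → β :=
  Quot.lift (fun q => φ (n := q.1.len) q.2.1.1 q.2.1.2 q.2.2) (by
    rintro _ _ ⟨f, x, t⟩
    exact h f.toOrderHom x.1 x.2 t)

theorem isQuotientMap_cells :
    Topology.IsQuotientMap (Quot.mk _ : PreRealization (simplicialReplacement D) → Hocolim D) :=
  isQuotientMap_quot_mk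

theorem continuous_preRealization_iff {β : Type*} [TopologicalSpace β]
    {f : PreRealization (simplicialReplacement D) → β} :
    Continuous f ↔ ∀ (n : ℕ) (σ : ComposableArrows J n),
      Continuous fun p : D.obj (σ.obj 0) × Simplex n =>
        f ⟨SimplexCategory.mk n, (⟨σ, p.1⟩ : ReplacementSpace D n), p.2⟩ := by
  refine ⟨fun h n σ => h.comp ?_, fun h => continuous_sigma fun n => ?_⟩
  · refine (continuous_sigmaMk (σ := fun n : SimplexCategory =>
      (simplicialReplacement D).obj (op n) × SimplexCategory.toTop₀.obj n)
        (i := SimplexCategory.mk n)).comp ?_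
    exact (continuous_sigmaMk (σ := fun τ : ComposableArrows J n => D.obj (τ.obj 0))).prodMap
      continuous_id
  · have h1 : Continuous fun p : (Σ σ : ComposableArrows J n.len,
        D.obj (σ.obj 0) × Simplex n.len) =>
        f ⟨n, (⟨p.1, p.2.1⟩ : ReplacementSpace D n.len), p.2.2⟩ :=
      continuous_sigma fun σ => h n.len σ
    exact h1.comp (Homeomorph.sigmaProdDistrib (Y := Simplex n.len)
      (X := fun σ : ComposableArrows J n.len => D.obj (σ.obj 0))).continuous

theorem continuous_hocolim_iff {β : Type*} [TopologicalSpace β] {f : Hocolim D → β} :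
    Continuous f ↔ ∀ (n : ℕ) (σ : ComposableArrows J n),
      Continuous fun p : D.obj (σ.obj 0) × Simplex n => f (cell σ p.1 p.2) :=
  isQuotientMap_cells.continuous_iff.trans continuous_preRealization_iff

theorem continuous_cell {n : ℕ} (σ : ComposableArrows J n) :
    Continuous fun p : D.obj (σ.obj 0) × Simplex n => cell σ p.1 p.2 :=
  continuous_hocolim_iff.1 continuous_id n σ

/-- A quotient map restricts to a quotient map over an open set, and each cell is an open summand of
the disjoint union. -/
theorem continuousOn_hocolim_of_isOpen {β : Type*} [TopologicalSpace β] {W : Set (Hocolim D)}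
    (hW : IsOpen W) {f : Hocolim D → β}
    (h : ∀ (n : ℕ) (σ : ComposableArrows J n), ContinuousOn
      (fun p : D.obj (σ.obj 0) × Simplex n => f (cell σ p.1 p.2))
        {p | cell σ p.1 p.2 ∈ W}) : ContinuousOn f W := by
  classical
  refine (isQuotientMap_cells.continuousOn_isOpen_iff hW).2
    ((hW.preimage isQuotientMap_cells.continuous).continuousOn_iff.2 ?_)
  rintro ⟨n, ⟨σ, x⟩, t⟩ hp
  have hV := hW.preimage (continuous_cell (D := D) σ)
  have h1 := (h n.len σ).continuousAt (x := (x, t)) (hV.mem_nhds hp)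
  let e : D.obj (σ.obj 0) × Simplex n.len → PreRealization (simplicialReplacement D) :=
    fun p => ⟨n, (⟨σ, p.1⟩ : ReplacementSpace D n.len), p.2⟩
  have he : Topology.IsOpenEmbedding e := by
    refine (Topology.IsOpenEmbedding.sigmaMk (σ := fun n : SimplexCategory =>
      (simplicialReplacement D).obj (op n) × SimplexCategory.toTop₀.obj n) (i := n)).comp ?_
    exact (Topology.IsOpenEmbedding.sigmaMk
      (σ := fun τ : ComposableArrows J n.len => D.obj (τ.obj 0))).prodMap
        Topology.IsOpenEmbedding.id
  exact (he.continuousAt_iff (x := (x, t))).1 h1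

theorem stdSimplex_map_apply {m n : ℕ} (θ : Fin (m + 1) → Fin (n + 1)) (t : Simplex m)
    (j : Fin (n + 1)) : stdSimplex.map θ t j = ∑ i with θ i = j, t i :=
  FunOnFinite.linearMap_apply_apply ℝ ℝ θ t j

theorem sum_stdSimplex_map {m n : ℕ} (θ : Fin (m + 1) → Fin (n + 1)) (t : Simplex m)
    (S : Finset (Fin (n + 1))) :
    ∑ j ∈ S, stdSimplex.map θ t j = ∑ i with θ i ∈ S, t i := by
  simp only [stdSimplex_map_apply]
  rw [← Finset.sum_biUnion]
  · congr 1
    ext i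
    simp
  · intro a _ b _ hab
    refine Finset.disjoint_left.2 fun i hi hi' => hab ?_
    rw [← (Finset.mem_filter.1 hi).2, (Finset.mem_filter.1 hi').2]

/-- A simplex coordinate can be moved along identities of the chain. -/
theorem cell_map_of_linked {n : ℕ} (σ : ComposableArrows J n) (x : D.obj (σ.obj 0))
    (t : Simplex n) (θ : Fin (n + 1) →o Fin (n + 1)) (h : ∀ i, Linked σ i (θ i)) :
    cell σ x t = cell σ x (stdSimplex.map θ t) := by
  rw [← cell_pull]
  refine cell_congr (sigma_chain_ext (fun i j hij => ?_) ?_) t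
  · rw [arr_pull]
    exact arr_eq_of_linked (h i) (h j) _ _
  · rw [trace_pull]
    exact (h 0).trace_eq x

end Cells

/-! ### Mass on colourable sets of vertices -/

section Colorings

variable {J : Type u} [SmallCategory J]

/-- A colouring of a set of objects of a chain is a monotone map to `{0, …, k - 1}` such that all
morphisms of the chain between objects of the same colour are identities. -/
structure IsColoring {n : ℕ} (σ : ComposableArrows J n) (k : ℕ) (S : Finset (Fin (n + 1)))
    (r : Fin (n + 1) → ℕ) : Prop where
  lt : ∀ i ∈ S, r i < k
  mono : ∀ i ∈ S, ∀ j ∈ S, i ≤ j → r i ≤ r j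
  linked : ∀ i ∈ S, ∀ j ∈ S, r i = r j → Linked σ i j

/-- The restriction of the chain to the set of objects degenerates to a chain of at most `k`
objects. -/
def Colorable {n : ℕ} (σ : ComposableArrows J n) (k : ℕ) (S : Finset (Fin (n + 1))) : Prop :=
  ∃ r, IsColoring σ k S r

/-- The object `i` belongs to the first of at most `k` groups of objects of a colouring. -/
def FirstColorable {n : ℕ} (σ : ComposableArrows J n) (k : ℕ) (S : Finset (Fin (n + 1)))
    (i : Fin (n + 1)) : Prop :=
  ∃ r, IsColoring σ k S r ∧ i ∈ S ∧ r i = 0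

variable {m n k : ℕ} {σ : ComposableArrows J n}

theorem IsColoring.subset {S T : Finset (Fin (n + 1))} {r : Fin (n + 1) → ℕ}
    (h : IsColoring σ k S r) (hT : T ⊆ S) : IsColoring σ k T r :=
  ⟨fun i hi => h.lt i (hT hi), fun i hi j hj => h.mono i (hT hi) j (hT hj),
    fun i hi j hj => h.linked i (hT hi) j (hT hj)⟩

theorem IsColoring.pred {S : Finset (Fin (n + 1))} {r : Fin (n + 1) → ℕ}
    (h : IsColoring σ (k + 1) S r) (h0 : ∀ i ∈ S, r i ≠ 0) : Colorable σ k S := by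
  refine ⟨fun i => r i - 1, ⟨fun i hi => ?_, fun i hi j hj hij => ?_, fun i hi j hj hij => ?_⟩⟩
  · have := h.lt i hi; have := h0 i hi; omega
  · have := h.mono i hi j hj hij; omega
  · have := h0 i hi; have := h0 j hj
    have hij : r i - 1 = r j - 1 := hij
    exact h.linked i hi j hj (by omega)

theorem colorable_empty (k : ℕ) : Colorable σ k ∅ :=
  ⟨fun _ => 0, ⟨by simp, by simp, by simp⟩⟩

theorem isColoring_id (h : n + 1 ≤ k) (S : Finset (Fin (n + 1))) :
    IsColoring σ k S fun i => (i : ℕ) :=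
  ⟨fun i _ => i.2.trans_le h, fun _ _ _ _ hij => hij,
    fun i _ j _ hij => by rw [Fin.ext hij]; exact Linked.refl j⟩

theorem IsColoring.preimage (θ : Fin (m + 1) →o Fin (n + 1)) {S : Finset (Fin (n + 1))}
    {r : Fin (n + 1) → ℕ} (h : IsColoring σ k S r) :
    IsColoring (pull θ σ) k {i | θ i ∈ S} (r ∘ θ) := by
  refine ⟨fun i hi => h.lt _ (by simpa using hi), fun i hi j hj hij =>
    h.mono _ (by simpa using hi) _ (by simpa using hj) (θ.monotone hij),
    fun i hi j hj hij => (linked_pull θ).2 (h.linked _ (by simpa using hi) _ (by simpa using hj)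
      hij)⟩

/-- Since `θ` may merge vertices of different colours, the colour of an image is read off at a
chosen preimage `g`. -/
theorem IsColoring.image (θ : Fin (m + 1) →o Fin (n + 1)) {S : Finset (Fin (m + 1))}
    {r : Fin (m + 1) → ℕ} (h : IsColoring (pull θ σ) k S r) {g : Fin (n + 1) → Fin (m + 1)}
    (hg : ∀ i ∈ S, g (θ i) ∈ S ∧ θ (g (θ i)) = θ i) :
    IsColoring σ k (S.image θ) (r ∘ g) := by
  have hg' : ∀ j ∈ S.image θ, g j ∈ S ∧ θ (g j) = j := by
    intro j hj
    obtain ⟨i, hi, rfl⟩ := Finset.mem_image.1 hj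
    exact hg i hi
  refine ⟨fun i hi => h.lt _ (hg' i hi).1, fun i hi j hj hij => ?_, fun i hi j hj hij => ?_⟩
  · rcases hij.eq_or_lt with rfl | hij
    · exact le_rfl
    · refine h.mono _ (hg' i hi).1 _ (hg' j hj).1 (le_of_not_gt fun hlt => ?_)
      have := θ.monotone hlt.le
      rw [(hg' i hi).2, (hg' j hj).2] at this
      exact this.not_gt hij
  · have := (linked_pull θ).1 (h.linked _ (hg' i hi).1 _ (hg' j hj).1 hij)
    rwa [(hg' i hi).2, (hg' j hj).2] at this

theorem exists_section_on (θ : Fin (m + 1) → Fin (n + 1)) (S : Finset (Fin (m + 1))) :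
    ∃ g : Fin (n + 1) → Fin (m + 1), ∀ i ∈ S, g (θ i) ∈ S ∧ θ (g (θ i)) = θ i := by
  classical
  refine ⟨fun j => if h : ∃ i ∈ S, θ i = j then h.choose else 0, fun i hi => ?_⟩
  have h : ∃ i' ∈ S, θ i' = θ i := ⟨i, hi, rfl⟩
  simp only [dif_pos h]
  exact h.choose_spec

theorem Colorable.image (θ : Fin (m + 1) →o Fin (n + 1)) {S : Finset (Fin (m + 1))}
    (h : Colorable (pull θ σ) k S) : Colorable σ k (S.image θ) := by
  obtain ⟨r, hr⟩ := h
  obtain ⟨g, hg⟩ := exists_section_on θ S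
  exact ⟨_, hr.image θ hg⟩

theorem FirstColorable.image (θ : Fin (m + 1) →o Fin (n + 1)) {S : Finset (Fin (m + 1))}
    {i : Fin (m + 1)} (h : FirstColorable (pull θ σ) k S i) :
    FirstColorable σ k (S.image θ) (θ i) := by
  classical
  obtain ⟨r, hr, hi, h0⟩ := h
  obtain ⟨g, hg⟩ := exists_section_on θ S
  -- The vertex `i` itself has to be the chosen preimage of `θ i`, so that `θ i` keeps colour `0`.
  refine ⟨_, hr.image θ (g := Function.update g (θ i) i) fun j hj => ?_,
    Finset.mem_image_of_mem θ hi, by simp [h0]⟩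
  by_cases hij : θ j = θ i
  · rw [hij, Function.update_self]
    exact ⟨hi, rfl⟩
  · rw [Function.update_of_ne hij]
    exact hg j hj

theorem Colorable.preimage (θ : Fin (m + 1) →o Fin (n + 1)) {S : Finset (Fin (n + 1))}
    (h : Colorable σ k S) : Colorable (pull θ σ) k {i | θ i ∈ S} := by
  obtain ⟨r, hr⟩ := h
  exact ⟨_, hr.preimage θ⟩

theorem FirstColorable.preimage (θ : Fin (m + 1) →o Fin (n + 1)) {S : Finset (Fin (n + 1))}
    {i : Fin (m + 1)} (h : FirstColorable σ k S (θ i)) :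
    FirstColorable (pull θ σ) k {i | θ i ∈ S} i := by
  obtain ⟨r, hr, hi, h0⟩ := h
  exact ⟨_, hr.preimage θ, by simpa using hi, h0⟩

/-- The sum of the coordinates over a set of vertices. -/
def mass (t : Simplex n) (S : Finset (Fin (n + 1))) : ℝ := ∑ i ∈ S, t i

theorem mass_mono (t : Simplex n) {S T : Finset (Fin (n + 1))} (h : S ⊆ T) :
    mass t S ≤ mass t T :=
  Finset.sum_le_sum_of_subset_of_nonneg h fun i _ _ => t.2.1 i

theorem mass_univ (t : Simplex n) : mass t Finset.univ = 1 := t.2.2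

theorem mass_le_one (t : Simplex n) (S : Finset (Fin (n + 1))) : mass t S ≤ 1 :=
  (mass_mono t (Finset.subset_univ S)).trans_eq (mass_univ t)

theorem mass_inter (t : Simplex n) (S T : Finset (Fin (n + 1))) :
    mass t S + mass t T - 1 ≤ mass t (S ∩ T) := by
  have h1 : mass t (S ∪ T) + mass t (S ∩ T) = mass t S + mass t T := Finset.sum_union_inter
  linarith [mass_le_one t (S ∪ T)]

theorem mass_map_preimage (θ : Fin (m + 1) → Fin (n + 1)) (t : Simplex m)
    (S : Finset (Fin (n + 1))) : mass (stdSimplex.map θ t) S = mass t {i | θ i ∈ S} :=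
  sum_stdSimplex_map θ t S

theorem mass_le_mass_image (θ : Fin (m + 1) → Fin (n + 1)) (t : Simplex m)
    (S : Finset (Fin (m + 1))) : mass t S ≤ mass (stdSimplex.map θ t) (S.image θ) := by
  rw [mass_map_preimage]
  exact mass_mono t fun i hi => by simpa using ⟨i, hi, rfl⟩

theorem continuous_coord (i : Fin (n + 1)) : Continuous fun t : Simplex n => t i :=
  (continuous_apply i).comp continuous_subtype_val

theorem continuous_mass (S : Finset (Fin (n + 1))) : Continuous fun t : Simplex n => mass t S :=
  continuous_finsetSum _ fun i _ => continuous_coord i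

open Classical in
/-- The maximal sum of the coordinates over a `k`-colourable set of vertices. -/
noncomputable def colorMass (σ : ComposableArrows J n) (k : ℕ) (t : Simplex n) : ℝ :=
  ({S | Colorable σ k S} : Finset (Finset (Fin (n + 1)))).sup'
    ⟨∅, Finset.mem_filter.2 ⟨Finset.mem_univ _, colorable_empty k⟩⟩ (mass t)

theorem Colorable.mass_le {S : Finset (Fin (n + 1))} (h : Colorable σ k S) (t : Simplex n) :
    mass t S ≤ colorMass σ k t := by
  classical
  exact Finset.le_sup' (mass t) (Finset.mem_filter.2 ⟨Finset.mem_univ _, h⟩)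

theorem colorMass_le {t : Simplex n} {c : ℝ} (h : ∀ S, Colorable σ k S → mass t S ≤ c) :
    colorMass σ k t ≤ c := by
  classical
  exact Finset.sup'_le _ _ fun S hS => h S (Finset.mem_filter.1 hS).2

theorem exists_colorable_mass_eq (σ : ComposableArrows J n) (k : ℕ) (t : Simplex n) :
    ∃ S, Colorable σ k S ∧ colorMass σ k t = mass t S := by
  classical
  obtain ⟨S, hS, h⟩ := Finset.exists_mem_eq_sup'
    (s := ({S | Colorable σ k S} : Finset (Finset (Fin (n + 1)))))
    ⟨∅, Finset.mem_filter.2 ⟨Finset.mem_univ _, colorable_empty k⟩⟩ (mass t)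
  exact ⟨S, (Finset.mem_filter.1 hS).2, h⟩

theorem continuous_colorMass : Continuous fun t : Simplex n => colorMass σ k t :=
  Continuous.finset_sup'_apply _ fun S _ => continuous_mass S

/-- Images and preimages of colourable sets are colourable, and neither operation loses mass. Hence
`colorMass` is a function on the homotopy colimit. -/
theorem colorMass_pull (θ : Fin (m + 1) →o Fin (n + 1)) (t : Simplex m) :
    colorMass (pull θ σ) k t = colorMass σ k (stdSimplex.map θ t) := by
  refine le_antisymm (colorMass_le fun S hS => ?_) (colorMass_le fun S hS => ?_)
  · exact (mass_le_mass_image θ t S).trans ((hS.image θ).mass_le _)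
  · rw [mass_map_preimage]
    exact (hS.preimage θ).mass_le t

theorem colorMass_le_one (t : Simplex n) : colorMass σ k t ≤ 1 :=
  colorMass_le fun S _ => mass_le_one t S

theorem colorMass_zero (t : Simplex n) : colorMass σ 0 t = 0 := by
  obtain ⟨S, ⟨r, hr⟩, h⟩ := exists_colorable_mass_eq σ 0 t
  obtain rfl : S = ∅ := Finset.eq_empty_of_forall_notMem fun i hi => (hr.lt i hi).not_ge (zero_le)
  rw [h]
  exact Finset.sum_empty

theorem colorMass_of_le (h : n + 1 ≤ k) (t : Simplex n) : colorMass σ k t = 1 :=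
  le_antisymm (colorMass_le_one t) ((mass_univ t).symm.trans_le
    (Colorable.mass_le ⟨_, isColoring_id h Finset.univ⟩ t))

open Classical in
/-- The weight of a vertex that lies in the first group of a colouring with `k + 1` colours. -/
noncomputable def firstWeight (σ : ComposableArrows J n) (k : ℕ) (t : Simplex n)
    (i : Fin (n + 1)) : ℝ :=
  Finset.univ.sup' Finset.univ_nonempty fun S : Finset (Fin (n + 1)) =>
    if FirstColorable σ (k + 1) S i then max 0 (2 * mass t S - 1 - colorMass σ k t) else 0

theorem firstWeight_nonneg (t : Simplex n) (i : Fin (n + 1)) : 0 ≤ firstWeight σ k t i := by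
  classical
  refine le_trans ?_ (Finset.le_sup' _ (Finset.mem_univ ∅))
  split_ifs
  · exact le_max_left _ _
  · exact le_rfl

theorem FirstColorable.le_firstWeight {S : Finset (Fin (n + 1))} {i : Fin (n + 1)}
    (h : FirstColorable σ (k + 1) S i) (t : Simplex n) :
    2 * mass t S - 1 - colorMass σ k t ≤ firstWeight σ k t i := by
  classical
  refine le_trans ?_ (Finset.le_sup' _ (Finset.mem_univ S))
  rw [if_pos h]
  exact le_max_right _ _

theorem firstWeight_le {t : Simplex n} {i : Fin (n + 1)} {c : ℝ} (h0 : 0 ≤ c)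
    (h : ∀ S, FirstColorable σ (k + 1) S i → 2 * mass t S - 1 - colorMass σ k t ≤ c) :
    firstWeight σ k t i ≤ c := by
  refine Finset.sup'_le _ _ fun S _ => ?_
  split_ifs with hS
  · exact max_le h0 (h S hS)
  · exact h0

theorem exists_of_firstWeight_pos {t : Simplex n} {i : Fin (n + 1)}
    (h : 0 < firstWeight σ k t i) :
    ∃ S, FirstColorable σ (k + 1) S i ∧ 1 + colorMass σ k t < 2 * mass t S := by
  by_contra! hcon
  exact h.not_ge (firstWeight_le le_rfl fun S hS => by linarith [hcon S hS])

theorem continuous_firstWeight (i : Fin (n + 1)) :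
    Continuous fun t : Simplex n => firstWeight σ k t i := by
  classical
  refine Continuous.finset_sup'_apply _ fun S _ => ?_
  split_ifs
  · have := continuous_mass S
    have := continuous_colorMass (σ := σ) (k := k)
    fun_prop
  · exact continuous_const

theorem firstWeight_pull (θ : Fin (m + 1) →o Fin (n + 1)) (t : Simplex m) (i : Fin (m + 1)) :
    firstWeight (pull θ σ) k t i = firstWeight σ k (stdSimplex.map θ t) (θ i) := by
  refine le_antisymm (firstWeight_le (firstWeight_nonneg _ _) fun S hS => ?_)
    (firstWeight_le (firstWeight_nonneg _ _) fun S hS => ?_)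
  · rw [colorMass_pull]
    exact le_trans (by linarith [mass_le_mass_image θ t S]) ((hS.image θ).le_firstWeight _)
  · rw [mass_map_preimage, ← colorMass_pull]
    exact (hS.preimage θ).le_firstWeight t

/-- Any two vertices of positive weight are linked by an identity. -/
theorem linked_of_firstWeight_pos {t : Simplex n} {i j : Fin (n + 1)}
    (hi : 0 < firstWeight σ k t i) (hj : 0 < firstWeight σ k t j) : Linked σ i j := by
  obtain ⟨S, ⟨r, hr, hiS, hi0⟩, hS⟩ := exists_of_firstWeight_pos hi
  obtain ⟨S', ⟨r', hr', hjS, hj0⟩, hS'⟩ := exists_of_firstWeight_pos hj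
  -- Both masses exceed `(1 + colorMass σ k t) / 2`, so the intersection has mass more than
  -- `colorMass σ k t`.
  have hT : ¬ Colorable σ k (S ∩ S') := fun h => by
    linarith [h.mass_le t, mass_inter t S S']
  have hne : (S ∩ S').Nonempty := by
    rw [Finset.nonempty_iff_ne_empty]
    intro h
    exact hT (h ▸ colorable_empty k)
  -- If the least common vertex had nonzero colour, colour `0` would be unused on the intersection,
  -- which would then be `k`-colourable. So this vertex lies in both first groups and links them.
  have key : ∀ {r : Fin (n + 1) → ℕ}, IsColoring σ (k + 1) (S ∩ S') r →
      r ((S ∩ S').min' hne) = 0 := by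
    intro r hr
    by_contra h
    refine hT (hr.pred fun a ha h0 => h ?_)
    have := hr.mono _ (Finset.min'_mem _ hne) a ha (Finset.min'_le _ a ha)
    omega
  have hm := Finset.mem_inter.1 (Finset.min'_mem _ hne)
  have h1 := hr.linked i hiS _ hm.1 (hi0.trans (key (hr.subset Finset.inter_subset_left)).symm)
  have h2 := hr'.linked j hjS _ hm.2 (hj0.trans (key (hr'.subset Finset.inter_subset_right)).symm)
  exact h1.trans h2.symm

theorem exists_firstWeight_pos {t : Simplex n}
    (h : 1 + colorMass σ k t < 2 * colorMass σ (k + 1) t) :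
    ∃ i, 0 < firstWeight σ k t i ∧ 0 < t i := by
  obtain ⟨S, ⟨r, hr⟩, hS⟩ := exists_colorable_mass_eq σ (k + 1) t
  by_contra! hcon
  have h0 : ∀ i ∈ S, r i = 0 → t i = 0 := fun i hi hi0 => by
    refine le_antisymm (hcon i ?_) (t.2.1 i)
    exact lt_of_lt_of_le (by linarith) (FirstColorable.le_firstWeight ⟨r, hr, hi, hi0⟩ t)
  -- If the first group carries no mass, discarding it leaves a `k`-colourable set of mass
  -- `colorMass σ (k + 1) t`, against the assumed jump.
  have hT : Colorable σ k (S.filter fun i => r i ≠ 0) :=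
    (hr.subset (Finset.filter_subset _ S)).pred fun i hi => (Finset.mem_filter.1 hi).2
  have h1 : mass t (S.filter fun i => r i ≠ 0) = mass t S :=
    Finset.sum_filter_of_ne fun i hi hti hri => hti (h0 i hi hri)
  have h2 := hT.mass_le t
  linarith [colorMass_le_one (σ := σ) (k := k) t]

end Colorings

/-! ### Faces and convex combinations in simplices -/

section Simplices

variable {m n : ℕ}

theorem stdSimplex_map_apply_pos {θ : Fin (m + 1) → Fin (n + 1)} {t : Simplex m} {i : Fin (m + 1)}
    (h : 0 < t i) : 0 < stdSimplex.map θ t (θ i) := by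
  rw [stdSimplex_map_apply]
  exact h.trans_le (Finset.single_le_sum (f := fun i => t i) (fun i _ => t.2.1 i)
    (Finset.mem_filter.2 ⟨Finset.mem_univ i, rfl⟩))

theorem exists_of_stdSimplex_map_apply_pos {θ : Fin (m + 1) → Fin (n + 1)} {t : Simplex m}
    {j : Fin (n + 1)} (h : 0 < stdSimplex.map θ t j) : ∃ i, θ i = j ∧ 0 < t i := by
  rw [stdSimplex_map_apply] at h
  by_contra! hcon
  exact h.not_ge (Finset.sum_nonpos fun i hi => hcon i (Finset.mem_filter.1 hi).2)

theorem exists_coord_pos (t : Simplex n) : ∃ i, 0 < t i := by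
  by_contra! hcon
  have : ∑ i, t i = 1 := t.2.2
  linarith [Finset.sum_nonpos fun i (_ : i ∈ Finset.univ) => hcon i]

/-- A point of a simplex is an interior point of a face. -/
theorem exists_face (t : Simplex n) : ∃ (m : ℕ) (θ : Fin (m + 1) →o Fin (n + 1)) (t' : Simplex m),
    stdSimplex.map θ t' = t ∧ ∀ i, 0 < t' i := by
  classical
  let S : Finset (Fin (n + 1)) := {i | 0 < t i}
  have hS : S.Nonempty := by
    obtain ⟨i, hi⟩ := exists_coord_pos t
    exact ⟨i, by simpa [S] using hi⟩
  obtain ⟨m, hm⟩ : ∃ m, S.card = m + 1 := Nat.exists_eq_succ_of_ne_zero hS.card_pos.ne'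
  let θ := S.orderEmbOfFin hm
  have himg : Finset.univ.image θ = S := by
    ext i
    rw [← Finset.mem_coe, ← Finset.mem_coe, Finset.coe_image, Finset.coe_univ, Set.image_univ]
    rw [Finset.range_orderEmbOfFin]
  have hpos : ∀ i, 0 < t (θ i) := fun i => (Finset.mem_filter.1 (S.orderEmbOfFin_mem hm i)).2
  have hzero : ∀ i ∉ S, t i = 0 := fun i hi =>
    le_antisymm (not_lt.1 fun h => hi (by simpa [S] using h)) (t.2.1 i)
  have hsum : ∑ i, t (θ i) = 1 := by
    rw [← Finset.sum_image (f := fun i => t i) (s := Finset.univ) (g := θ)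
      fun i _ j _ h => θ.injective h, himg, Finset.sum_subset (Finset.subset_univ S)
      fun i _ hi => hzero i hi]
    exact t.2.2
  let t' : Simplex m := ⟨fun i => t (θ i), fun i => (hpos i).le, hsum⟩
  have ht' : ∀ i, t' i = t (θ i) := fun _ => rfl
  refine ⟨m, θ.toOrderHom, t', ?_, fun i => (ht' i).symm ▸ hpos i⟩
  ext j
  rw [stdSimplex_map_apply]
  by_cases hj : j ∈ S
  · rw [← himg] at hj
    obtain ⟨i, _, rfl⟩ := Finset.mem_image.1 hj
    rw [Finset.sum_eq_single i]
    · exact ht' i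
    · exact fun i' hi' hne => absurd (θ.injective (Finset.mem_filter.1 hi').2) hne
    · intro h
      exact (h (by simp)).elim
  · rw [hzero j hj]
    refine Finset.sum_eq_zero fun i hi => absurd ?_ hj
    rw [← (Finset.mem_filter.1 hi).2]
    exact S.orderEmbOfFin_mem hm i

/-- The point `(1 - s) t + s z` of a simplex. -/
noncomputable def mix (t z : Simplex n) (s : unitInterval) : Simplex n :=
  ⟨(1 - (s : ℝ)) • t.1 + (s : ℝ) • z.1, (convex_stdSimplex ℝ (Fin (n + 1))) t.2 z.2
    (sub_nonneg.2 s.2.2) s.2.1 (by ring)⟩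

theorem mix_apply (t z : Simplex n) (s : unitInterval) (i : Fin (n + 1)) :
    mix t z s i = (1 - (s : ℝ)) * t i + s * z i := rfl

theorem mix_zero (t z : Simplex n) : mix t z 0 = t := by
  ext i
  rw [mix_apply]
  simp

theorem mix_one (t z : Simplex n) : mix t z 1 = z := by
  ext i
  rw [mix_apply]
  simp

theorem map_mix (θ : Fin (m + 1) → Fin (n + 1)) (t z : Simplex m) (s : unitInterval) :
    stdSimplex.map θ (mix t z s) = mix (stdSimplex.map θ t) (stdSimplex.map θ z) s := by
  ext i
  simp only [stdSimplex_map_apply, mix_apply, Finset.sum_add_distrib, Finset.mul_sum]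

theorem continuous_mix :
    Continuous fun p : (Simplex n × Simplex n) × unitInterval => mix p.1.1 p.1.2 p.2 := by
  refine Continuous.subtype_mk ?_ _
  fun_prop

end Simplices

/-! ### The weighted average of the first group -/

section FirstVertex

variable {J : Type u} [SmallCategory J] {m n k : ℕ} {σ : ComposableArrows J n}

/-- The total weight of the vertices in the first group. -/
noncomputable def firstTotal (σ : ComposableArrows J n) (k : ℕ) (t : Simplex n) : ℝ :=
  ∑ i, t i * firstWeight σ k t i

theorem continuous_firstTotal : Continuous fun t : Simplex n => firstTotal σ k t :=
  continuous_finsetSum _ fun i _ => (continuous_coord i).mul (continuous_firstWeight i)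

theorem firstTotal_pos {t : Simplex n} (h : 1 + colorMass σ k t < 2 * colorMass σ (k + 1) t) :
    0 < firstTotal σ k t := by
  obtain ⟨i, hi, hti⟩ := exists_firstWeight_pos h
  exact Finset.sum_pos' (fun j _ => mul_nonneg (t.2.1 j) (firstWeight_nonneg t j))
    ⟨i, Finset.mem_univ i, mul_pos hti hi⟩

theorem sum_map_mul_firstWeight (θ : Fin (m + 1) →o Fin (n + 1)) (t : Simplex m)
    (j : Fin (n + 1)) : stdSimplex.map θ t j * firstWeight σ k (stdSimplex.map θ t) j =
      ∑ i with θ i = j, t i * firstWeight (pull θ σ) k t i := by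
  rw [stdSimplex_map_apply, Finset.sum_mul]
  refine Finset.sum_congr rfl fun i hi => ?_
  rw [firstWeight_pull, (Finset.mem_filter.1 hi).2]

theorem firstTotal_pull (θ : Fin (m + 1) →o Fin (n + 1)) (t : Simplex m) :
    firstTotal (pull θ σ) k t = firstTotal σ k (stdSimplex.map θ t) := by
  unfold firstTotal
  simp only [sum_map_mul_firstWeight]
  exact (Finset.sum_fiberwise Finset.univ θ _).symm

open Classical in
/-- The point of a simplex whose coordinates are proportional to the weights of the vertices in
the first group. -/
noncomputable def firstPoint (σ : ComposableArrows J n) (k : ℕ) (t : Simplex n) : Simplex n :=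
  if h : 0 < firstTotal σ k t then
    ⟨fun i => t i * firstWeight σ k t i / firstTotal σ k t,
      fun i => div_nonneg (mul_nonneg (t.2.1 i) (firstWeight_nonneg t i)) h.le, by
        rw [← Finset.sum_div]
        exact div_self h.ne'⟩
  -- A default value that keeps `map_firstPoint` true without a positivity hypothesis.
  else t

theorem firstPoint_apply {t : Simplex n} (h : 0 < firstTotal σ k t) (i : Fin (n + 1)) :
    firstPoint σ k t i = t i * firstWeight σ k t i / firstTotal σ k t := by
  rw [firstPoint, dif_pos h]; rfl

theorem map_firstPoint (θ : Fin (m + 1) →o Fin (n + 1)) (t : Simplex m) :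
    stdSimplex.map θ (firstPoint (pull θ σ) k t) = firstPoint σ k (stdSimplex.map θ t) := by
  by_cases h : 0 < firstTotal σ k (stdSimplex.map θ t)
  · have h' : 0 < firstTotal (pull θ σ) k t := by rwa [firstTotal_pull]
    ext j
    rw [firstPoint_apply h, stdSimplex_map_apply, sum_map_mul_firstWeight, Finset.sum_div]
    refine Finset.sum_congr rfl fun i _ => ?_
    rw [firstPoint_apply h', firstTotal_pull]
  · have h' : ¬ 0 < firstTotal (pull θ σ) k t := by rwa [firstTotal_pull]
    rw [firstPoint, dif_neg h', firstPoint, dif_neg h]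

theorem continuousOn_firstPoint :
    ContinuousOn (fun t : Simplex n => firstPoint σ k t) {t | 0 < firstTotal σ k t} := by
  rw [continuousOn_iff_continuous_domRestrict, Topology.IsInducing.subtypeVal.continuous_iff]
  refine continuous_pi fun i => ?_
  have h : ∀ t : {t : Simplex n | 0 < firstTotal σ k t},
      firstTotal σ k t.1 ≠ 0 := fun t => ne_of_gt t.2
  have h1 := (continuous_coord i).comp (continuous_subtype_val
    (p := fun t : Simplex n => 0 < firstTotal σ k t))
  have h2 := (continuous_firstWeight (σ := σ) (k := k) i).comp (continuous_subtype_val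
    (p := fun t : Simplex n => 0 < firstTotal σ k t))
  have h3 := (continuous_firstTotal (σ := σ) (k := k)).comp (continuous_subtype_val
    (p := fun t : Simplex n => 0 < firstTotal σ k t))
  exact ((h1.mul h2).div h3 h).congr fun t => (firstPoint_apply t.2 i).symm

end FirstVertex

/-! ### Deforming neighbourhoods of open cells to vertices -/

section VertexNeighbourhoods

variable {J : Type u} [SmallCategory J] {D : J ⥤ TopCat.{u}}

/-- The inclusion of the spaces of the diagram into the homotopy colimit. -/
noncomputable def vertexMap (D : J ⥤ TopCat.{u}) : C(Σ j, D.obj j, Hocolim D) :=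
  ⟨fun z => cell (ComposableArrows.mk₀ z.1) z.2 default, continuous_sigma fun j =>
    (continuous_cell (D := D) (ComposableArrows.mk₀ j)).comp
      (continuous_id.prodMk continuous_const)⟩

/-- A cell point all of whose vertices are linked by identities lies in the image of the spaces
of the diagram. -/
theorem cell_eq_vertexMap {n : ℕ} {σ : ComposableArrows J n} {x : D.obj (σ.obj 0)} {t : Simplex n}
    (h : ∀ i j, 0 < t i → 0 < t j → Linked σ i j) {i : Fin (n + 1)} (hi : 0 < t i) :
    cell σ x t = vertexMap D (trace σ i x) := by
  obtain ⟨m, θ, t', rfl, ht'⟩ := exists_face t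
  have hl : ∀ a b, Linked (pull θ σ) a b := fun a b => (linked_pull θ).2
    (h _ _ (stdSimplex_map_apply_pos (ht' a)) (stdSimplex_map_apply_pos (ht' b)))
  obtain ⟨a, rfl, -⟩ := exists_of_stdSimplex_map_apply_pos hi
  rw [(h _ _ hi (stdSimplex_map_apply_pos (ht' 0))).trace_eq x, ← cell_pull]
  -- All objects of the remaining face are linked, so its chain is the degeneracy along `κ` of a
  -- chain with one object.
  let κ : Fin (m + 1) →o Fin (0 + 1) := ⟨fun _ => 0, fun _ _ _ => le_rfl⟩
  let τ : ComposableArrows J 0 := ComposableArrows.mk₀ (σ.obj (θ 0))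
  let y : D.obj (τ.obj 0) := push σ (θ 0) x
  have h1 : cell (pull κ τ) (push τ (κ 0) y) t' = vertexMap D (trace σ (θ 0) x) := by
    rw [cell_pull]
    exact congrArg (cell τ y) (Subsingleton.elim _ _)
  rw [← h1]
  refine cell_congr (sigma_chain_ext (fun i j hij => ?_) ?_) t'
  · rw [arr_eq_of_linked (hl i 0) (hl j 0) hij le_rfl]
    obtain ⟨b, hb⟩ := isIdent_arr_refl (pull θ σ) 0
    refine hb.trans ?_
    obtain rfl : (pull θ σ).obj 0 = b := congrArg Sigma.fst hb
    rfl
  · rw [trace_pull, trace_pull]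
    exact congrArg (Sigma.mk (β := fun j => D.obj j) (σ.obj (θ 0))) (push_zero (σ := τ) y).symm

theorem continuous_lift {β : Type*} [TopologicalSpace β]
    {φ : ∀ {n : ℕ} (σ : ComposableArrows J n), D.obj (σ.obj 0) → Simplex n → β}
    {h : ∀ {m n : ℕ} (θ : Fin (m + 1) →o Fin (n + 1)) (σ : ComposableArrows J n)
      (x : D.obj (σ.obj 0)) (t : Simplex m),
      φ (pull θ σ) (push σ (θ 0) x) t = φ σ x (stdSimplex.map θ t)}
    (hc : ∀ (n : ℕ) (σ : ComposableArrows J n),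
      Continuous fun p : D.obj (σ.obj 0) × Simplex n => φ σ p.1 p.2) :
    Continuous (Hocolim.lift φ h) :=
  continuous_hocolim_iff.2 hc

/-- The sets where this function is positive are numerable neighbourhoods of the interiors of the
`k`-dimensional cells. -/
noncomputable def gap (D : J ⥤ TopCat.{u}) (k : ℕ) : C(Hocolim D, ℝ) :=
  ⟨Hocolim.lift (fun σ _ t => max 0 (2 * colorMass σ (k + 1) t - 1 - colorMass σ k t))
    fun θ σ x t => by simp only [colorMass_pull], continuous_lift fun n σ => by
      have h1 := (continuous_colorMass (σ := σ) (k := k)).comp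
        (continuous_snd (X := D.obj (σ.obj 0)))
      have h2 := (continuous_colorMass (σ := σ) (k := k + 1)).comp
        (continuous_snd (X := D.obj (σ.obj 0)))
      exact continuous_const.max (((continuous_const.mul h2).sub continuous_const).sub h1)⟩

theorem gap_cell {n : ℕ} (σ : ComposableArrows J n) (x : D.obj (σ.obj 0)) (t : Simplex n) (k : ℕ) :
    gap D k (cell σ x t) = max 0 (2 * colorMass σ (k + 1) t - 1 - colorMass σ k t) := rfl

theorem gap_pos_iff {n k : ℕ} {σ : ComposableArrows J n} {x : D.obj (σ.obj 0)} {t : Simplex n} :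
    0 < gap D k (cell σ x t) ↔ 1 + colorMass σ k t < 2 * colorMass σ (k + 1) t := by
  rw [gap_cell, lt_max_iff, or_iff_right (lt_irrefl _)]
  constructor <;> intro h <;> linarith

theorem exists_gap_pos (p : Hocolim D) : ∃ k, 0 < gap D k p := by
  obtain ⟨n, σ, x, t, rfl⟩ := exists_cell p
  have hex : ∃ k, colorMass σ (k + 1) t = 1 := ⟨n, colorMass_of_le le_rfl t⟩
  classical
  -- At the least `k` with `colorMass σ (k + 1) t = 1`, the value for `k` is still below `1`.
  refine ⟨Nat.find hex, gap_pos_iff.2 ?_⟩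
  rw [Nat.find_spec hex]
  have : colorMass σ (Nat.find hex) t < 1 := by
    refine lt_of_le_of_ne (colorMass_le_one t) ?_
    rcases h : Nat.find hex with _ | l
    · rw [colorMass_zero]; exact zero_ne_one
    · exact Nat.find_min hex (h ▸ Nat.lt_succ_self l)
  linarith

/-- The path in the homotopy colimit from a point to the first vertices. -/
noncomputable def firstPath (D : J ⥤ TopCat.{u}) (k : ℕ) :
    Hocolim D → C(unitInterval, Hocolim D) :=
  Hocolim.lift (fun σ x t => ⟨fun s => cell σ x (mix t (firstPoint σ k t) s),
    (continuous_cell σ).comp (f := fun s => (x, mix t (firstPoint σ k t) s))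
      (continuous_const.prodMk (continuous_mix.comp
        (f := fun s => ((t, firstPoint σ k t), s)) (continuous_const.prodMk continuous_id)))⟩)
    fun θ σ x t => by
    ext1 s
    change cell _ _ _ = cell _ _ _
    rw [cell_pull, map_mix, map_firstPoint]

/-- With values in the path space, continuity can be checked on cells; the product of the quotient
with the interval never has to be presented as a quotient. -/
theorem continuousOn_firstPath (k : ℕ) :
    ContinuousOn (firstPath D k) {p | 0 < gap D k p} := by
  refine continuousOn_hocolim_of_isOpen
    (isOpen_lt continuous_const (gap D k).continuous) fun n σ => ?_
  rw [continuousOn_iff_continuous_domRestrict]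
  refine ContinuousMap.continuous_of_continuous_uncurry _ ?_
  have h1 : Continuous fun q : {p : D.obj (σ.obj 0) × Simplex n | 0 < gap D k (cell σ p.1 p.2)} =>
      firstPoint σ k q.1.2 := by
    have := (continuousOn_firstPoint (σ := σ) (k := k)).comp (continuous_snd.continuousOn
      (s := {p : D.obj (σ.obj 0) × Simplex n | 0 < gap D k (cell σ p.1 p.2)}))
      fun p hp => firstTotal_pos (gap_pos_iff.1 hp)
    exact continuousOn_iff_continuous_domRestrict.1 this
  exact (continuous_cell σ).comp (((continuous_fst.comp continuous_subtype_val).comp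
    continuous_fst).prodMk (continuous_mix.comp ((((continuous_snd.comp
      continuous_subtype_val).prodMk h1).comp continuous_fst).prodMk continuous_snd)))

/-- The traces of a point at the vertices in the first group. -/
def firstTraces (D : J ⥤ TopCat.{u}) (k : ℕ) : Hocolim D → Set (Σ j, D.obj j) :=
  Hocolim.lift (fun σ x t => {z | ∃ i, 0 < firstWeight σ k t i ∧ 0 < t i ∧ z = trace σ i x})
    fun θ σ x t => by
    ext z
    constructor
    · rintro ⟨i, hi, hti, rfl⟩
      exact ⟨θ i, by rwa [firstWeight_pull] at hi, stdSimplex_map_apply_pos hti, trace_pull θ i x⟩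
    · rintro ⟨i, hi, hti, rfl⟩
      obtain ⟨i, rfl, hi'⟩ := exists_of_stdSimplex_map_apply_pos hti
      exact ⟨i, by rwa [firstWeight_pull], hi', (trace_pull θ i x).symm⟩

theorem mem_firstTraces {n k : ℕ} {σ : ComposableArrows J n} {x : D.obj (σ.obj 0)} {t : Simplex n}
    {z : Σ j, D.obj j} : z ∈ firstTraces D k (cell σ x t) ↔
      ∃ i, 0 < firstWeight σ k t i ∧ 0 < t i ∧ z = trace σ i x := Iff.rfl

theorem firstTraces_nonempty {k : ℕ} {p : Hocolim D} (h : 0 < gap D k p) :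
    (firstTraces D k p).Nonempty := by
  obtain ⟨n, σ, x, t, rfl⟩ := exists_cell p
  obtain ⟨i, hi, hti⟩ := exists_firstWeight_pos (gap_pos_iff.1 h)
  exact ⟨_, mem_firstTraces.2 ⟨i, hi, hti, rfl⟩⟩

theorem firstTraces_subsingleton (k : ℕ) (p : Hocolim D) :
    (firstTraces D k p).Subsingleton := by
  obtain ⟨n, σ, x, t, rfl⟩ := exists_cell p
  rintro _ ⟨i, hi, -, rfl⟩ _ ⟨j, hj, -, rfl⟩
  exact (linked_of_firstWeight_pos hi hj).trace_eq x

/-- The trace does not depend on the vertex chosen in the first group. On a cell, a vertex that is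
admissible at a point stays admissible nearby, so the choice agrees locally with the trace at one
fixed vertex. -/
theorem exists_firstTrace (k : ℕ) : ∃ c : C({p | 0 < gap D k p}, Σ j, D.obj j),
    ∀ p, c p ∈ firstTraces D k p.1 := by
  classical
  have hW : IsOpen {p | 0 < gap D k p} := isOpen_lt continuous_const (gap D k).continuous
  rcases isEmpty_or_nonempty (Σ j, D.obj j) with he | ⟨⟨z₀⟩⟩
  · have : IsEmpty {p | 0 < gap D k p} := ⟨fun p => he.false (firstTraces_nonempty p.2).some⟩
    exact ⟨⟨fun p => isEmptyElim p, continuous_of_discreteTopology⟩, fun p => isEmptyElim p⟩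
  · let c : Hocolim D → Σ j, D.obj j := fun p =>
      if h : 0 < gap D k p then (firstTraces_nonempty h).some else z₀
    have hc : ∀ p, 0 < gap D k p → c p ∈ firstTraces D k p := fun p hp => by
      simp only [c, dif_pos hp]
      exact (firstTraces_nonempty hp).some_mem
    refine ⟨⟨_, continuousOn_iff_continuous_domRestrict.1
      (continuousOn_hocolim_of_isOpen (f := c) hW fun n σ => ?_)⟩, fun p => hc p.1 p.2⟩
    intro p hp
    obtain ⟨i, hi, hti, hz⟩ := mem_firstTraces.1 (hc _ hp)
    have hnhds : {q : D.obj (σ.obj 0) × Simplex n | 0 < firstWeight σ k q.2 i ∧ 0 < q.2 i} ∈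
        nhds p := ((isOpen_lt continuous_const ((continuous_firstWeight i).comp
          continuous_snd)).inter (isOpen_lt continuous_const ((continuous_coord i).comp
            continuous_snd))).mem_nhds ⟨hi, hti⟩
    refine (((continuous_trace i).comp continuous_fst).continuousWithinAt).congr_of_eventuallyEq
      ?_ hz
    filter_upwards [mem_nhdsWithin_of_mem_nhds hnhds, self_mem_nhdsWithin] with q hq hqW
    exact firstTraces_subsingleton k _ (hc _ hqW) (mem_firstTraces.2 ⟨i, hq.1, hq.2, rfl⟩)

theorem homotopic_vertexMap {k : ℕ} {c : C({p | 0 < gap D k p}, Σ j, D.obj j)}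
    (hc : ∀ p, c p ∈ firstTraces D k p.1) :
    (incl {p | 0 < gap D k p}).Homotopic ((vertexMap D).comp c) := by
  have hG : Continuous fun p : {p | 0 < gap D k p} => firstPath D k p.1 :=
    continuousOn_iff_continuous_domRestrict.1 (continuousOn_firstPath k)
  refine ⟨⟨⟨fun q => firstPath D k q.2.1 q.1, ?_⟩, ?_, ?_⟩⟩
  · exact ContinuousEval.continuous_eval.comp ((hG.comp continuous_snd).prodMk continuous_fst)
  · rintro ⟨p, hp⟩
    obtain ⟨n, σ, x, t, rfl⟩ := exists_cell p
    exact congrArg (cell σ x) (mix_zero t _)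
  · intro p
    have hcp := hc p
    obtain ⟨p, hp⟩ := p
    obtain ⟨n, σ, x, t, rfl⟩ := exists_cell p
    obtain ⟨i, hi, hti, hz⟩ := mem_firstTraces.1 hcp
    refine (congrArg (cell σ x) (mix_one t _)).trans ?_
    change _ = vertexMap D (c _)
    rw [hz]
    -- The end point of the path is supported on vertices of positive weight, which are pairwise
    -- linked.
    have htot := firstTotal_pos (gap_pos_iff.1 hp)
    refine cell_eq_vertexMap (fun a b ha hb => ?_) ?_
    · rw [firstPoint_apply htot] at ha hb
      refine linked_of_firstWeight_pos (k := k) (t := t)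
        ((firstWeight_nonneg t a).lt_of_ne fun h => ?_)
        ((firstWeight_nonneg t b).lt_of_ne fun h => ?_)
      · rw [← h, mul_zero, zero_div] at ha; exact lt_irrefl _ ha
      · rw [← h, mul_zero, zero_div] at hb; exact lt_irrefl _ hb
    · rw [firstPoint_apply htot]
      exact div_pos (mul_pos hti hi) htot

theorem isDoldSpace_hocolim (h : ∀ j, IsDoldSpace (D.obj j)) : IsDoldSpace (Hocolim D) := by
  obtain ⟨p, hp⟩ := exists_partitionOfUnity_nat (gap D) (fun k q => by
    obtain ⟨n, σ, x, t, rfl⟩ := exists_cell q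
    exact le_max_left _ _) exists_gap_pos
  choose c hc using exists_firstTrace (D := D)
  exact isDoldSpace_of_partitionOfUnity
    (fun k => isOpen_lt continuous_const (gap D k).continuous) p hp
    (fun _ => isDoldSpace_sigma h) c (fun _ => vertexMap D) fun k => homotopic_vertexMap (hc k)

end VertexNeighbourhoods

/-! ### The radial retraction of `Δⁿ × [0, 1]` -/

section RadialRetraction

variable {n : ℕ}

/-- The boundary of a simplex. -/
def simplexBoundary (n : ℕ) : Set (Simplex n) := {t | ∃ i, t i = 0}

theorem isClosed_simplexBoundary : IsClosed (simplexBoundary n) := by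
  have : simplexBoundary n = ⋃ i, {t : Simplex n | t i = 0} := by
    ext t; simp [simplexBoundary]
  rw [this]
  exact isClosed_iUnion_of_finite fun i => isClosed_eq (continuous_coord i) continuous_const

/-- The minimal barycentric coordinate. -/
noncomputable def minCoord (t : Simplex n) : ℝ :=
  Finset.univ.inf' Finset.univ_nonempty fun i => t i

theorem continuous_minCoord : Continuous (minCoord (n := n)) :=
  Continuous.finset_inf'_apply _ fun i _ => continuous_coord i

theorem minCoord_le (t : Simplex n) (i : Fin (n + 1)) : minCoord t ≤ t i :=
  Finset.inf'_le _ (Finset.mem_univ i)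

theorem exists_minCoord_eq (t : Simplex n) : ∃ i, minCoord t = t i := by
  obtain ⟨i, -, h⟩ := Finset.exists_mem_eq_inf' Finset.univ_nonempty fun i => t i
  exact ⟨i, h⟩

theorem minCoord_nonneg (t : Simplex n) : 0 ≤ minCoord t := by
  obtain ⟨i, hi⟩ := exists_minCoord_eq t
  exact hi ▸ t.2.1 i

theorem minCoord_eq_zero {t : Simplex n} (h : t ∈ simplexBoundary n) : minCoord t = 0 := by
  obtain ⟨i, hi⟩ := h
  exact le_antisymm ((minCoord_le t i).trans_eq hi) (minCoord_nonneg t)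

/-- The dilation factor of the projection of `Δⁿ × [0, 1]` from a point above its centre to
`∂Δⁿ × [0, 1] ∪ Δⁿ × {0}`. -/
noncomputable def dilation (p : Simplex n × unitInterval) : ℝ :=
  2 / max (2 * (1 - (n + 1) * minCoord p.1)) (2 - p.2)

theorem dilation_aux (p : Simplex n × unitInterval) :
    1 ≤ max (2 * (1 - (n + 1) * minCoord p.1)) (2 - (p.2 : ℝ)) :=
  le_max_of_le_right (by linarith [p.2.2.2])

theorem continuous_dilation : Continuous (dilation (n := n)) := by
  have h1 : ∀ p : Simplex n × unitInterval,
      max (2 * (1 - (n + 1) * minCoord p.1)) (2 - (p.2 : ℝ)) ≠ 0 :=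
    fun p => ne_of_gt (one_pos.trans_le (dilation_aux p))
  have h2 := continuous_minCoord (n := n)
  exact continuous_const.div (by fun_prop) h1

theorem one_le_dilation (p : Simplex n × unitInterval) : 1 ≤ dilation p := by
  rw [dilation, le_div_iff₀ (one_pos.trans_le (dilation_aux p)), one_mul]
  refine max_le ?_ (by linarith [p.2.2.1])
  nlinarith [minCoord_nonneg p.1, (n.cast_nonneg : (0 : ℝ) ≤ n)]

/-- Together with `one_le_dilation`, this makes `dilation p - 1` a time in the unit interval. -/
theorem dilation_le_two (p : Simplex n × unitInterval) : dilation p ≤ 2 := by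
  rw [dilation, div_le_iff₀ (one_pos.trans_le (dilation_aux p))]
  linarith [dilation_aux p]

theorem dilation_mul_le (p : Simplex n × unitInterval) :
    dilation p * (1 - (n + 1) * minCoord p.1) ≤ 1 := by
  have h0 := one_pos.trans_le (dilation_aux p)
  rw [dilation, div_mul_eq_mul_div, div_le_one h0]
  exact le_max_left _ _

/-- The ray from (barycentre, `2`) through `p` meets the boundary of the simplex at the factor in
the first equation and height `0` at that in the second; `dilation p` is whichever comes first. -/
theorem dilation_cases (p : Simplex n × unitInterval) :
    dilation p * (1 - (n + 1) * minCoord p.1) = 1 ∨ dilation p * (2 - p.2) = 2 := by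
  have h0 := one_pos.trans_le (dilation_aux p)
  rw [dilation, div_mul_eq_mul_div, div_mul_eq_mul_div, div_eq_iff h0.ne', div_eq_iff h0.ne']
  rcases max_choice (2 * (1 - (n + 1) * minCoord p.1)) (2 - (p.2 : ℝ)) with h | h
  · left; rw [h]; ring
  · right; rw [h]

theorem dilation_eq_one {p : Simplex n × unitInterval} (h : p.2 = 0 ∨ p.1 ∈ simplexBoundary n) :
    dilation p = 1 := by
  rcases h with h | h
  · have : 2 * (1 - (n + 1) * minCoord p.1) ≤ 2 - (p.2 : ℝ) := by
      rw [h]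
      have := minCoord_nonneg p.1
      simp only [Set.Icc.coe_zero]
      nlinarith [(n.cast_nonneg : (0 : ℝ) ≤ n)]
    rw [dilation, max_eq_right this, h]
    norm_num
  · have : 2 - (p.2 : ℝ) ≤ 2 * (1 - (n + 1) * minCoord p.1) := by
      rw [minCoord_eq_zero h]
      linarith [p.2.2.1]
    rw [dilation, max_eq_left this, minCoord_eq_zero h]
    norm_num

/-- The height of a point of the ray through a point of `Δⁿ × [0, 1]`. -/
noncomputable def rayHeight (ρ : ℝ) (s : unitInterval) : unitInterval :=
  Set.projIcc 0 1 zero_le_one (2 + ρ * (s - 2))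

theorem rayHeight_one (s : unitInterval) : rayHeight 1 s = s := by
  have : (2 + 1 * ((s : ℝ) - 2)) = s := by ring
  rw [rayHeight, this]
  exact Set.projIcc_val zero_le_one s

theorem continuous_rayHeight : Continuous fun p : ℝ × unitInterval => rayHeight p.1 p.2 :=
  continuous_projIcc.comp (by fun_prop)

/-- The radial projection of `Δⁿ × [0, 1]` to `Δⁿ`. -/
noncomputable def raySimplex (p : Simplex n × unitInterval) : Simplex n :=
  ⟨fun i => 1 / (n + 1) + dilation p * (p.1 i - 1 / (n + 1)), by
    have hn : (0 : ℝ) < n + 1 := by positivity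
    refine ⟨fun i => ?_, ?_⟩
    · have h1 := dilation_mul_le p
      have h2 := mul_le_mul_of_nonneg_left (minCoord_le p.1 i)
        (zero_le_one.trans (one_le_dilation p))
      have h3 : 1 / ((n : ℝ) + 1) + dilation p * (p.1 i - 1 / (n + 1)) =
          (1 - dilation p * (1 - (n + 1) * p.1 i)) / (n + 1) := by
        field_simp
        ring
      beta_reduce
      rw [h3]
      refine div_nonneg ?_ hn.le
      nlinarith
    · have : ∑ i, p.1 i = 1 := p.1.2.2
      rw [Finset.sum_add_distrib, ← Finset.mul_sum, Finset.sum_sub_distrib, this]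
      simp only [Finset.sum_const, Finset.card_univ, Fintype.card_fin, nsmul_eq_mul]
      push_cast
      field_simp
      ring⟩

theorem raySimplex_apply (p : Simplex n × unitInterval) (i : Fin (n + 1)) :
    raySimplex p i = 1 / (n + 1) + dilation p * (p.1 i - 1 / (n + 1)) := rfl

theorem continuous_raySimplex : Continuous (raySimplex (n := n)) := by
  refine Continuous.subtype_mk (continuous_pi fun i => ?_) _
  exact continuous_const.add (continuous_dilation.mul
    (((continuous_coord i).comp continuous_fst).sub continuous_const))

theorem raySimplex_eq {p : Simplex n × unitInterval} (h : dilation p = 1) :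
    raySimplex p = p.1 := by
  ext i
  rw [raySimplex_apply, h]
  ring

theorem ray_mem (p : Simplex n × unitInterval) :
    rayHeight (dilation p) p.2 = 0 ∨ raySimplex p ∈ simplexBoundary n := by
  rcases dilation_cases p with h | h
  · right
    obtain ⟨i, hi⟩ := exists_minCoord_eq p.1
    refine ⟨i, ?_⟩
    have hn : ((n : ℝ) + 1) ≠ 0 := by positivity
    rw [raySimplex_apply, ← hi]
    field_simp
    linarith
  · left
    have : 2 + dilation p * ((p.2 : ℝ) - 2) = 0 := by linarith
    rw [rayHeight, this]
    exact Set.projIcc_left _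

end RadialRetraction

/-! ### Extending a homotopy over one cell -/

section CellExtension

/-- The extension of a homotopy from `Y × ∂Δⁿ ∪ {y₀} × Δⁿ` to `Y × Δⁿ`. -/
theorem HasHomotopyExtension.exists_extension_prod_simplex {Y Z : Type u} [TopologicalSpace Y]
    [TopologicalSpace Z] {y₀ : Y} (hY : HasHomotopyExtension (incl ({y₀} : Set Y))) {n : ℕ}
    (f : C(Y × Simplex n, Z)) (γ : C(unitInterval, Z)) (hγ : ∀ t, f (y₀, t) = γ 0)
    (b : Y × Simplex n → C(unitInterval, Z))
    (hb : ContinuousOn b {p | p.2 ∈ simplexBoundary n})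
    (hb0 : ∀ p, p.2 ∈ simplexBoundary n → b p 0 = f p)
    (hbγ : ∀ t ∈ simplexBoundary n, b (y₀, t) = γ) :
    ∃ E : C(Y × Simplex n, C(unitInterval, Z)), (∀ p, p.2 ∈ simplexBoundary n → E p = b p) ∧
      (∀ p, E p 0 = f p) ∧ ∀ t, E (y₀, t) = γ := by
  classical
  let g : Y × (Simplex n × unitInterval) → Z := fun q =>
    if q.2.2 = 0 then f (q.1, q.2.1) else b (q.1, q.2.1) q.2.2
  have g0 : ∀ q : Y × (Simplex n × unitInterval), q.2.2 = 0 → g q = f (q.1, q.2.1) :=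
    fun q hq => if_pos hq
  have gb : ∀ q : Y × (Simplex n × unitInterval), q.2.1 ∈ simplexBoundary n →
      g q = b (q.1, q.2.1) q.2.2 := fun q hq => by
    by_cases h0 : q.2.2 = 0
    · rw [g0 q h0, h0, hb0 _ hq]
    · exact if_neg h0
  have hg : ContinuousOn g ({q | q.2.2 = 0} ∪ {q | q.2.1 ∈ simplexBoundary n}) := by
    refine ContinuousOn.union_of_isClosed ?_ ?_ (isClosed_eq (by fun_prop) continuous_const)
      (isClosed_simplexBoundary.preimage (f := fun q : Y × (Simplex n × unitInterval) => q.2.1)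
        (by fun_prop))
    · exact (f.continuous.comp (by fun_prop :
        Continuous fun q : Y × (Simplex n × unitInterval) => (q.1, q.2.1))).continuousOn.congr g0
    · have h1 : ContinuousOn (fun q : Y × (Simplex n × unitInterval) => b (q.1, q.2.1))
          {q | q.2.1 ∈ simplexBoundary n} :=
        hb.comp (by fun_prop : Continuous fun q : Y × (Simplex n × unitInterval) =>
          (q.1, q.2.1)).continuousOn fun q hq => hq
      have h2 : ContinuousOn (fun q : Y × (Simplex n × unitInterval) => q.2.2)
          {q | q.2.1 ∈ simplexBoundary n} := by fun_prop
      exact (ContinuousEval.continuous_eval.comp_continuousOn (h1.prodMk h2)).congr gb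
  let R : Simplex n × unitInterval → Simplex n × unitInterval := fun p =>
    (raySimplex p, rayHeight (dilation p) p.2)
  have hR : Continuous R := continuous_raySimplex.prodMk
    (continuous_rayHeight.comp (continuous_dilation.prodMk continuous_snd))
  have hR1 : ∀ p, dilation p = 1 → R p = p := fun p hp =>
    Prod.ext (raySimplex_eq hp) (by simp only [R, hp, rayHeight_one])
  have hgR : Continuous fun q : Y × (Simplex n × unitInterval) => g (q.1, R q.2) :=
    hg.comp_continuous (f := fun q : Y × (Simplex n × unitInterval) => (q.1, R q.2))
      (continuous_fst.prodMk (hR.comp continuous_snd)) fun q => ray_mem q.2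
  have hgγ : ∀ p : Simplex n × unitInterval, (p.2 = 0 ∨ p.1 ∈ simplexBoundary n) →
      g (y₀, p) = γ p.2 := by
    rintro p (hp | hp)
    · rw [g0 _ hp, hγ, hp]
    · rw [gb _ hp, hbγ _ hp]
  -- Composing `g` with the retraction `R` ignores the condition at `y₀`: there it gives `γ` at the
  -- height of `R p` instead of that of `p`. The homotopy `h'` lowers the dilation factor towards
  -- `1` to correct this, and is extended over `Y`.
  let f' : C(Y, C(Simplex n × unitInterval, Z)) := ContinuousMap.curry ⟨_, hgR⟩
  let h' : C(({y₀} : Set Y) × unitInterval, C(Simplex n × unitInterval, Z)) :=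
    ContinuousMap.curry ⟨fun q => γ (rayHeight (max 1 (dilation q.2 - q.1.2)) q.2.2),
      γ.continuous.comp (continuous_rayHeight.comp
        (f := fun q : (({y₀} : Set Y) × unitInterval) × (Simplex n × unitInterval) =>
          (max 1 (dilation q.2 - q.1.2), q.2.2)) (by
        have := continuous_dilation (n := n)
        fun_prop))⟩
  obtain ⟨H, H0, H1⟩ := hY (C(Simplex n × unitInterval, Z)) f' h' (by
    rintro ⟨_, rfl⟩
    ext1 p
    refine Eq.trans ?_ (hgγ _ (ray_mem p)).symm
    change γ (rayHeight (max 1 (dilation p - ((0 : unitInterval) : ℝ))) p.2) = γ (R p).2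
    rw [Set.Icc.coe_zero, sub_zero, max_eq_right (one_le_dilation p)])
  -- Stopping at time `dilation p - 1` brings the factor at `y₀` exactly to `1`, and leaves the map
  -- unchanged where `R` is the identity.
  let w : Simplex n × unitInterval → unitInterval := fun p =>
    ⟨dilation p - 1, by linarith [one_le_dilation p], by linarith [dilation_le_two p]⟩
  have hw : Continuous w := Continuous.subtype_mk (continuous_dilation.sub continuous_const) _
  let e : C((Y × Simplex n) × unitInterval, Z) :=
    ⟨fun q => H (q.1.1, w (q.1.2, q.2)) (q.1.2, q.2), ContinuousEval.continuous_eval.comp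
      ((H.continuous.comp (by fun_prop)).prodMk (by fun_prop))⟩
  have he : ∀ y (p : Simplex n × unitInterval), (p.2 = 0 ∨ p.1 ∈ simplexBoundary n) →
      e ((y, p.1), p.2) = g (y, p) := by
    intro y p hp
    have hd := dilation_eq_one hp
    have hw0 : w p = 0 := Subtype.ext (by simp [w, hd])
    change H (y, w p) p = _
    rw [hw0, H0]
    change g (y, R p) = _
    rw [hR1 p hd]
  refine ⟨e.curry, fun p hp => ?_, fun p => ?_, fun t => ?_⟩
  · ext1 s
    exact (he p.1 (p.2, s) (Or.inr hp)).trans (gb _ hp)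
  · exact (he p.1 (p.2, 0) (Or.inl rfl)).trans (g0 _ rfl)
  · ext1 s
    change H (y₀, w (t, s)) (t, s) = _
    have := H1 ⟨y₀, rfl⟩ (w (t, s))
    change H (y₀, w (t, s)) = _ at this
    rw [this]
    change γ (rayHeight (max 1 (dilation (t, s) - (dilation (t, s) - 1))) s) = _
    rw [sub_sub_cancel, max_self, rayHeight_one]

end CellExtension

/-! ### Uniqueness of nondegenerate presentations -/

section NormalForms

variable {J : Type u} [SmallCategory J] {D : J ⥤ TopCat.{u}}

theorem stdSimplex_map_congr {m n : ℕ} {f g : Fin (m + 1) → Fin (n + 1)} {t : Simplex m}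
    (h : ∀ i, 0 < t i → f i = g i) : stdSimplex.map f t = stdSimplex.map g t := by
  ext j
  rw [stdSimplex_map_apply, stdSimplex_map_apply, Finset.sum_filter, Finset.sum_filter]
  refine Finset.sum_congr rfl fun i _ => ?_
  rcases (t.2.1 i).eq_or_lt with h0 | h0
  · have h0 : t i = 0 := h0.symm
    simp [h0]
  · rw [h i h0]

/-- None of the morphisms of the chain is an identity. -/
def Nondegenerate {n : ℕ} (σ : ComposableArrows J n) : Prop :=
  ∀ (a b : Fin (n + 1)) (h : a ≤ b), (b : ℕ) = a + 1 → ¬ IsIdent (arr σ h)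

/-- The function `r` exhibits `(τ, y, s)` as a presentation of the cell point `(σ, x, t)`. -/
structure IsPresentation {n m : ℕ} (σ : ComposableArrows J n) (x : D.obj (σ.obj 0)) (t : Simplex n)
    (τ : ComposableArrows J m) (y : D.obj (τ.obj 0)) (s : Simplex m)
    (r : Fin (m + 1) → Fin (n + 1)) : Prop where
  map_eq : stdSimplex.map r s = t
  arr_eq : ∀ i j (hij : i ≤ j), 0 < s i → 0 < s j → ∃ h : r i ≤ r j, arr τ hij = arr σ h
  trace_eq : ∀ i, 0 < s i → trace τ i y = trace σ (r i) x

variable {n : ℕ} {σ : ComposableArrows J n} {x : D.obj (σ.obj 0)} {t : Simplex n}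

theorem IsPresentation.surjective {m : ℕ} {τ : ComposableArrows J m} {y : D.obj (τ.obj 0)}
    {s : Simplex m} {r : Fin (m + 1) → Fin (n + 1)} (h : IsPresentation σ x t τ y s r)
    (ht : ∀ i, 0 < t i) (c : Fin (n + 1)) : ∃ i, r i = c ∧ 0 < s i :=
  exists_of_stdSimplex_map_apply_pos (h.map_eq.symm ▸ ht c)

/-- On vertices of positive coordinate, `r` factors through `θ`. If `r` separated two vertices with
the same image under `θ`, a vertex between them would map to `r i + 1`, and the identity in the
pulled back chain would be an identity between consecutive objects of `σ`. -/
theorem IsPresentation.map_of_pull {m m' : ℕ} (hσ : Nondegenerate σ) (ht : ∀ i, 0 < t i)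
    (θ : Fin (m + 1) →o Fin (m' + 1)) {τ : ComposableArrows J m'} {y : D.obj (τ.obj 0)}
    {s : Simplex m} {r : Fin (m + 1) → Fin (n + 1)}
    (h : IsPresentation σ x t (pull θ τ) (push τ (θ 0) y) s r) :
    ∃ r', IsPresentation σ x t τ y (stdSimplex.map θ s) r' := by
  classical
  have key : ∀ i i', 0 < s i → 0 < s i' → θ i = θ i' → i ≤ i' → r i = r i' := by
    intro i i' hi hi' hθ hle
    obtain ⟨hr, -⟩ := h.arr_eq i i' hle hi hi'
    by_contra hne
    have hlt : (r i : ℕ) < r i' := lt_of_le_of_ne hr fun h => hne (Fin.ext h)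
    let c : Fin (n + 1) := ⟨r i + 1, by omega⟩
    obtain ⟨l, hil, hli, hlc, hl⟩ : ∃ l, i ≤ l ∧ l ≤ i' ∧ r l = c ∧ 0 < s l := by
      obtain ⟨l, hlc, hl⟩ := h.surjective ht c
      have hil : i ≤ l := by
        by_contra hlt'
        obtain ⟨h1, -⟩ := h.arr_eq l i (not_le.1 hlt').le hl hi
        rw [hlc] at h1
        exact absurd (show (c : ℕ) ≤ r i from h1) (by simp [c])
      by_cases hli : l ≤ i'
      · exact ⟨l, hil, hli, hlc, hl⟩
      -- Here `r i < r i' ≤ r i + 1`, so `i'` itself serves as `l`.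
      · obtain ⟨h1, -⟩ := h.arr_eq i' l (not_le.1 hli).le hi' hl
        rw [hlc] at h1
        refine ⟨i', hle, le_rfl, le_antisymm h1 ?_, hi'⟩
        exact hlt
    obtain ⟨h1, h2⟩ := h.arr_eq i l hil hi hl
    have hθl : θ l = θ i := le_antisymm ((θ.monotone hli).trans_eq hθ.symm) (θ.monotone hil)
    refine hσ (r i) (r l) h1 (by rw [hlc]) ?_
    rw [← h2, arr_pull]
    have h3 : Linked τ (θ i) (θ l) := hθl ▸ Linked.refl _
    exact h3.isIdent _
  have key' : ∀ i i', 0 < s i → 0 < s i' → θ i = θ i' → r i = r i' := by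
    intro i i' hi hi' hθ
    rcases le_total i i' with hle | hle
    · exact key i i' hi hi' hθ hle
    · exact (key i' i hi' hi hθ.symm hle).symm
  let r' : Fin (m' + 1) → Fin (n + 1) := fun j =>
    if h : ∃ i, θ i = j ∧ 0 < s i then r h.choose else 0
  have hr' : ∀ i, 0 < s i → r' (θ i) = r i := by
    intro i hi
    have hex : ∃ i', θ i' = θ i ∧ 0 < s i' := ⟨i, rfl, hi⟩
    simp only [r', dif_pos hex]
    exact key' _ _ hex.choose_spec.2 hi hex.choose_spec.1
  refine ⟨r', ?_, ?_, ?_⟩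
  · rw [stdSimplex.map_comp_apply, ← h.map_eq]
    exact stdSimplex_map_congr hr'
  · intro j j' hjj' hj hj'
    obtain ⟨i, rfl, hi⟩ := exists_of_stdSimplex_map_apply_pos hj
    obtain ⟨i', rfl, hi'⟩ := exists_of_stdSimplex_map_apply_pos hj'
    rw [hr' i hi, hr' i' hi']
    rcases le_total i i' with hle | hle
    · exact h.arr_eq i i' hle hi hi'
    · have hθ : θ i = θ i' := le_antisymm hjj' (θ.monotone hle)
      obtain ⟨h1, h2⟩ := h.arr_eq i i le_rfl hi hi
      refine ⟨(key' i i' hi hi' hθ).le, ?_⟩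
      refine (arr_eq_of_linked (Linked.refl (θ i)) (hθ ▸ Linked.refl _) _ le_rfl).trans
        (h2.trans ?_)
      exact arr_eq_of_linked (Linked.refl (r i)) ((key' i i' hi hi' hθ) ▸ Linked.refl _) _ _
  · intro j hj
    obtain ⟨i, rfl, hi⟩ := exists_of_stdSimplex_map_apply_pos hj
    rw [hr' i hi, ← h.trace_eq i hi, trace_pull]

theorem IsPresentation.pull {m m' : ℕ} (θ : Fin (m + 1) →o Fin (m' + 1))
    {τ : ComposableArrows J m'} {y : D.obj (τ.obj 0)} {s : Simplex m}
    {r : Fin (m' + 1) → Fin (n + 1)} (h : IsPresentation σ x t τ y (stdSimplex.map θ s) r) :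
    IsPresentation σ x t (pull θ τ) (push τ (θ 0) y) s (r ∘ θ) := by
  refine ⟨?_, fun i j hij hi hj => ?_, fun i hi => ?_⟩
  · rw [← h.map_eq, stdSimplex.map_comp_apply]
  · exact h.arr_eq _ _ (θ.monotone hij) (stdSimplex_map_apply_pos hi) (stdSimplex_map_apply_pos hj)
  · rw [trace_pull]
    exact h.trace_eq _ (stdSimplex_map_apply_pos hi)

theorem IsPresentation.refl : IsPresentation σ x t σ x t id :=
  ⟨stdSimplex.map_id_apply t, fun _ _ hij _ _ => ⟨hij, rfl⟩, fun _ _ => rfl⟩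

/-- Every presentation of an interior point of a nondegenerate cell maps to this cell. -/
theorem exists_isPresentation (hσ : Nondegenerate σ) (ht : ∀ i, 0 < t i) {m : ℕ}
    {τ : ComposableArrows J m} {y : D.obj (τ.obj 0)} {s : Simplex m}
    (h : cell τ y s = cell σ x t) : ∃ r, IsPresentation σ x t τ y s r := by
  let P : Hocolim D → Prop := Hocolim.lift (fun τ y s => ∃ r, IsPresentation σ x t τ y s r)
    fun θ τ y s => propext ⟨fun ⟨r, hr⟩ => hr.map_of_pull hσ ht θ, fun ⟨r, hr⟩ => ⟨_, hr.pull θ⟩⟩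
  have : P (cell τ y s) = P (cell σ x t) := congrArg P h
  exact this.mpr ⟨id, IsPresentation.refl⟩

theorem le_of_cell_eq (hσ : Nondegenerate σ) (ht : ∀ i, 0 < t i) {m : ℕ}
    {τ : ComposableArrows J m} {y : D.obj (τ.obj 0)} {s : Simplex m}
    (h : cell τ y s = cell σ x t) : n ≤ m := by
  obtain ⟨r, hr⟩ := exists_isPresentation hσ ht h
  have hsurj : Function.Surjective r := fun c => (hr.surjective ht c).imp fun _ h => h.1
  simpa using Fintype.card_le_of_surjective r hsurj

/-- The map `r` of a presentation is surjective, hence bijective for equal dimensions; then all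
coordinates are positive, so `r` is monotone and thus the identity. -/
theorem eq_of_cell_eq (hσ : Nondegenerate σ) (ht : ∀ i, 0 < t i)
    {τ : ComposableArrows J n} {y : D.obj (τ.obj 0)} {s : Simplex n}
    (h : cell τ y s = cell σ x t) :
    (⟨τ, y⟩ : ReplacementSpace D n) = ⟨σ, x⟩ ∧ s = t := by
  obtain ⟨r, hr⟩ := exists_isPresentation hσ ht h
  have hsurj : Function.Surjective r := fun c => (hr.surjective ht c).imp fun _ h => h.1
  have hinj : Function.Injective r := Finite.injective_iff_surjective.2 hsurj
  have hs : ∀ i, 0 < s i := fun i => by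
    obtain ⟨j, hj, hj'⟩ := hr.surjective ht (r i)
    rwa [hinj hj] at hj'
  have hmono : StrictMono r := Monotone.strictMono_of_injective
    (fun i j hij => (hr.arr_eq i j hij (hs i) (hs j)).1) hinj
  obtain rfl : r = id := (hmono.range_inj strictMono_id).1
    (by rw [hsurj.range_eq, Set.range_id])
  refine ⟨sigma_chain_ext (fun i j hij => ?_) (hr.trace_eq 0 (hs 0)), ?_⟩
  · exact (hr.arr_eq i j hij (hs i) (hs j)).2
  · rw [← hr.map_eq, stdSimplex.map_id_apply]

end NormalForms

/-! ### Induction over skeleta -/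

section Skeleta

variable {J : Type u} [SmallCategory J] {D : J ⥤ TopCat.{u}}

/-- The image of the cells of dimension less than `N`. -/
def skeleton (D : J ⥤ TopCat.{u}) (N : ℕ) : Set (Hocolim D) :=
  {p | ∃ m < N, ∃ (σ : ComposableArrows J m) (x : D.obj (σ.obj 0)) (t : Simplex m), cell σ x t = p}

theorem skeleton_mono {M N : ℕ} (h : M ≤ N) : skeleton D M ⊆ skeleton D N := by
  rintro p ⟨m, hm, hp⟩
  exact ⟨m, hm.trans_le h, hp⟩

theorem cell_mem_skeleton {m N : ℕ} (h : m < N) (σ : ComposableArrows J m) (x : D.obj (σ.obj 0))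
    (t : Simplex m) : cell σ x t ∈ skeleton D N := ⟨m, h, σ, x, t, rfl⟩

/-- A point of a facet, with the vanishing coordinate omitted. -/
def facetPoint {n : ℕ} (i : Fin (n + 2)) (t : {t : Simplex (n + 1) // t i = 0}) : Simplex n :=
  ⟨fun j => t.1 (i.succAbove j), fun j => t.1.2.1 _, by
    have h : ∑ j, t.1 j = 1 := t.1.2.2
    rw [Fin.sum_univ_succAbove _ i, t.2, zero_add] at h
    exact h⟩

theorem continuous_facetPoint {n : ℕ} (i : Fin (n + 2)) : Continuous (facetPoint (n := n) i) :=
  Continuous.subtype_mk (continuous_pi fun _ => (continuous_coord _).comp continuous_subtype_val) _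

theorem map_facetPoint {n : ℕ} (i : Fin (n + 2)) (t : {t : Simplex (n + 1) // t i = 0}) :
    stdSimplex.map (Fin.succAboveOrderEmb i).toOrderHom (facetPoint i t) = t.1 := by
  ext j
  rw [stdSimplex_map_apply]
  change ∑ l with i.succAbove l = j, t.1 (i.succAbove l) = _
  rcases Fin.eq_self_or_eq_succAbove i j with rfl | ⟨l, rfl⟩
  · rw [t.2]
    exact Finset.sum_eq_zero fun l hl => absurd (Finset.mem_filter.1 hl).2 (Fin.succAbove_ne _ l)
  · rw [Finset.sum_eq_single l]
    · exact fun l' hl' hne => absurd (Fin.succAbove_right_injective (Finset.mem_filter.1 hl').2) hne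
    · intro h
      exact (h (by simp)).elim

theorem cell_facet {n : ℕ} (σ : ComposableArrows J (n + 1)) (x : D.obj (σ.obj 0)) (i : Fin (n + 2))
    (t : {t : Simplex (n + 1) // t i = 0}) :
    cell σ x t.1 = cell (pull (Fin.succAboveOrderEmb i).toOrderHom σ)
      (push σ ((Fin.succAboveOrderEmb i).toOrderHom 0) x) (facetPoint i t) := by
  rw [cell_pull, map_facetPoint]

theorem boundary_ind {P : ∀ {n : ℕ}, ComposableArrows J n → Simplex n → Prop}
    (h : ∀ {n : ℕ} (σ : ComposableArrows J (n + 1)) (i : Fin (n + 2))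
      (t : {t : Simplex (n + 1) // t i = 0}), P σ t.1) {n : ℕ} (σ : ComposableArrows J n)
    {t : Simplex n} (ht : t ∈ simplexBoundary n) : P σ t := by
  obtain ⟨i, hi⟩ := ht
  rcases n with _ | n
  · exfalso
    have h1 : ∑ j, t j = 1 := t.2.2
    have h2 : ∑ j, t j = t i := Fintype.sum_eq_single i fun _ hj => absurd (Fin.ext (by omega)) hj
    linarith
  · exact h σ i ⟨t, hi⟩

theorem cell_mem_skeleton_of_boundary {n : ℕ} {σ : ComposableArrows J n} {x : D.obj (σ.obj 0)}
    {t : Simplex n} (ht : t ∈ simplexBoundary n) : cell σ x t ∈ skeleton D n :=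
  boundary_ind (P := fun {n} σ t => ∀ x : D.obj (σ.obj 0), cell σ x t ∈ skeleton D n)
    (fun {n} σ i t x => by
      rw [cell_facet]
      exact cell_mem_skeleton n.lt_succ_self _ _ _) σ ht x

/-- The boundary is a finite union of closed facets, and on each facet the cell is a cell of lower
dimension. -/
theorem continuousOn_boundary {β : Type*} [TopologicalSpace β] {F : Hocolim D → β} {n : ℕ}
    (hF : ∀ m < n, ∀ σ : ComposableArrows J m,
      Continuous fun p : D.obj (σ.obj 0) × Simplex m => F (cell σ p.1 p.2))
    (σ : ComposableArrows J n) : ContinuousOn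
      (fun p : D.obj (σ.obj 0) × Simplex n => F (cell σ p.1 p.2))
        {p | p.2 ∈ simplexBoundary n} := by
  rcases n with _ | n
  · intro p hp
    exact (boundary_ind (J := J) (P := fun {n} _ _ => n ≠ 0) (fun _ _ _ => Nat.succ_ne_zero _)
      σ hp rfl).elim
  · have hU : {p : D.obj (σ.obj 0) × Simplex (n + 1) | p.2 ∈ simplexBoundary (n + 1)} =
        ⋃ i, {p | p.2 i = 0} := by
      ext p; simp [simplexBoundary]
    rw [hU]
    refine (locallyFinite_of_finite _).continuousOn_iUnion
      (fun i => isClosed_eq ((continuous_coord i).comp continuous_snd) continuous_const) fun i => ?_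
    rw [continuousOn_iff_continuous_domRestrict]
    have h1 := hF n n.lt_succ_self (pull (Fin.succAboveOrderEmb i).toOrderHom σ)
    have h2 : Continuous fun q : {p : D.obj (σ.obj 0) × Simplex (n + 1) | p.2 i = 0} =>
        facetPoint i ⟨q.1.2, q.2⟩ :=
      (continuous_facetPoint i).comp (Continuous.subtype_mk (by fun_prop) _)
    have h3 : Continuous fun q : {p : D.obj (σ.obj 0) × Simplex (n + 1) | p.2 i = 0} =>
        push σ ((Fin.succAboveOrderEmb i).toOrderHom 0) q.1.1 :=
      (continuous_push _).comp (continuous_fst.comp continuous_subtype_val)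
    refine (h1.comp (h3.prodMk h2)).congr fun q => ?_
    exact congrArg F (cell_facet σ q.1.1 i ⟨q.1.2, q.2⟩).symm

/-- The points of a degenerate cell lie on its boundary. -/
theorem exists_boundary_map {n : ℕ} {σ : ComposableArrows J n} (h : ¬ Nondegenerate σ) :
    ∃ θ : Fin (n + 1) → Fin (n + 1), ∀ t : Simplex n,
      stdSimplex.map θ t ∈ simplexBoundary n ∧
        ∀ x : D.obj (σ.obj 0), cell σ x t = cell σ x (stdSimplex.map θ t) := by
  simp only [Nondegenerate, not_forall, not_not] at h
  obtain ⟨a, b, hab, hb, hid⟩ := h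
  have hne : a ≠ b := by rintro rfl; omega
  -- Moving the coordinate of `b` to `a` along the identity makes the `b`-th coordinate zero.
  let θ : Fin (n + 1) →o Fin (n + 1) := ⟨fun i => if i = b then a else i, fun i j hij => by
    have : (i : ℕ) ≤ j := hij
    beta_reduce
    split_ifs with h1 h2 h2
    · exact le_rfl
    · subst h1; exact hab.trans hij
    · subst h2
      have : (i : ℕ) ≠ j := fun h => h1 (Fin.ext h)
      change (i : ℕ) ≤ a
      omega
    · exact hij⟩
  refine ⟨θ, fun t => ⟨⟨b, ?_⟩, fun x => cell_map_of_linked σ x t θ fun i => ?_⟩⟩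
  · rw [stdSimplex_map_apply]
    refine Finset.sum_eq_zero fun i hi => absurd (Finset.mem_filter.1 hi).2 ?_
    change (if i = b then a else i) ≠ b
    split_ifs with h1
    · exact hne
    · exact h1
  · change Linked σ i (if i = b then a else i)
    split_ifs with h1
    · subst h1
      exact Or.inr ⟨hab, hid⟩
    · exact Linked.refl i

theorem continuous_stdSimplex_map {m n : ℕ} (θ : Fin (m + 1) → Fin (n + 1)) :
    Continuous fun t : Simplex m => stdSimplex.map θ t := stdSimplex.continuous_map θ

variable (base : ∀ j, D.obj j) {Z : Type u} [TopologicalSpace Z] (f : C(Hocolim D, Z))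
  (γ : C(unitInterval, Z))

/-- A function that restricts on the cells of dimension less than `N` to an extension of the
homotopy. -/
structure IsPartialExtension (N : ℕ) (F : Hocolim D → C(unitInterval, Z)) : Prop where
  cont : ∀ m < N, ∀ σ : ComposableArrows J m,
    Continuous fun p : D.obj (σ.obj 0) × Simplex m => F (cell σ p.1 p.2)
  zero : ∀ p ∈ skeleton D N, F p 0 = f p
  base : ∀ m < N, ∀ (σ : ComposableArrows J m) (t : Simplex m), F (cell σ (base _) t) = γ

variable {base f γ}

theorem IsPartialExtension.boundary (hbase : ∀ {i j : J} (g : i ⟶ j), D.map g (base i) = base j)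
    {n : ℕ} {F : Hocolim D → C(unitInterval, Z)} (hF : IsPartialExtension base f γ n F)
    (σ : ComposableArrows J n) {t : Simplex n} (ht : t ∈ simplexBoundary n) :
    F (cell σ (base _) t) = γ :=
  boundary_ind (P := fun {n} σ t => IsPartialExtension base f γ n F → F (cell σ (base _) t) = γ)
    (fun {n} σ i t hF => by
      rw [cell_facet, push, hbase]
      exact hF.base n n.lt_succ_self _ _) σ ht hF

/-- Nondegenerate cells of dimension `n` can be treated independently, because their interiors are
disjoint from each other and from lower cells. A degenerate cell is already covered by its boundary.
-/
theorem IsPartialExtension.exists_succ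
    (hbase : ∀ {i j : J} (g : i ⟶ j), D.map g (base i) = base j)
    (hep : ∀ j, HasHomotopyExtension (incl ({base j} : Set (D.obj j))))
    (hf : ∀ {n : ℕ} (σ : ComposableArrows J n) (t : Simplex n), f (cell σ (base _) t) = γ 0)
    {n : ℕ} {F : Hocolim D → C(unitInterval, Z)} (hF : IsPartialExtension base f γ n F) :
    ∃ F', IsPartialExtension base f γ (n + 1) F' ∧ ∀ p ∈ skeleton D n, F' p = F p := by
  classical
  have hext := fun σ : ComposableArrows J n => (hep (σ.obj 0)).exists_extension_prod_simplex
    (⟨_, f.continuous.comp (continuous_cell σ)⟩ : C(D.obj (σ.obj 0) × Simplex n, Z)) γ (hf σ)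
    (fun p => F (cell σ p.1 p.2)) (continuousOn_boundary hF.cont σ)
    (fun p hp => hF.zero _ (cell_mem_skeleton_of_boundary hp)) fun t ht => hF.boundary hbase σ ht
  choose E hE hE0 hEγ using hext
  let F' : Hocolim D → C(unitInterval, Z) := fun p =>
    if p ∈ skeleton D n then F p else
      -- Off the lower skeleton the presentation `q` is unique, so the choice is harmless; the last
      -- `F p` is a default for points not yet reached.
      if h : ∃ q : (Σ σ : ComposableArrows J n, D.obj (σ.obj 0) × Simplex n),
        cell q.1 q.2.1 q.2.2 = p then E h.choose.1 h.choose.2 else F p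
  have hF1 : ∀ p ∈ skeleton D n, F' p = F p := fun p hp => if_pos hp
  have hF2 : ∀ (σ : ComposableArrows J n), Nondegenerate σ → ∀ p : D.obj (σ.obj 0) × Simplex n,
      F' (cell σ p.1 p.2) = E σ p := by
    intro σ hσ p
    by_cases hp : p.2 ∈ simplexBoundary n
    · rw [hF1 _ (cell_mem_skeleton_of_boundary hp), hE σ p hp]
    · have ht : ∀ i, 0 < p.2 i := fun i =>
        lt_of_le_of_ne (p.2.2.1 i) fun h => hp ⟨i, h.symm⟩
      have hn : cell σ p.1 p.2 ∉ skeleton D n := by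
        rintro ⟨m, hm, τ, y, s, h⟩
        exact hm.not_ge (le_of_cell_eq hσ ht h)
      have hex : ∃ q : (Σ σ : ComposableArrows J n, D.obj (σ.obj 0) × Simplex n),
        cell q.1 q.2.1 q.2.2 = cell σ p.1 p.2 := ⟨⟨σ, p⟩, rfl⟩
      simp only [F', if_neg hn, dif_pos hex]
      obtain ⟨h1, h2⟩ := eq_of_cell_eq hσ ht hex.choose_spec
      have h3 : hex.choose = ⟨σ, p⟩ := by
        generalize hex.choose = q at h1 h2
        obtain ⟨τ, y, s⟩ := q
        obtain ⟨x, t⟩ := p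
        cases h1
        cases h2
        rfl
      rw [h3]
  have hF3 : ∀ (σ : ComposableArrows J n), ¬ Nondegenerate σ →
      ∃ θ : Fin (n + 1) → Fin (n + 1), ∀ t : Simplex n, stdSimplex.map θ t ∈ simplexBoundary n ∧
        ∀ x : D.obj (σ.obj 0), cell σ x t = cell σ x (stdSimplex.map θ t) ∧
          F' (cell σ x t) = F (cell σ x (stdSimplex.map θ t)) := by
    intro σ hσ
    obtain ⟨θ, hθ⟩ := exists_boundary_map (D := D) hσ
    refine ⟨θ, fun t => ⟨(hθ t).1, fun x => ⟨(hθ t).2 x, ?_⟩⟩⟩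
    rw [(hθ t).2 x, hF1 _ (cell_mem_skeleton_of_boundary (hθ t).1)]
  refine ⟨F', ⟨fun m hm σ => ?_, ?_, fun m hm σ t => ?_⟩, hF1⟩
  · rcases (Nat.lt_succ_iff.1 hm).lt_or_eq with hm | rfl
    · exact (hF.cont m hm σ).congr fun p => (hF1 _ (cell_mem_skeleton hm σ _ _)).symm
    · by_cases hσ : Nondegenerate σ
      · exact (E σ).continuous.congr fun p => (hF2 σ hσ p).symm
      · obtain ⟨θ, hθ⟩ := hF3 σ hσ
        refine ((continuousOn_boundary hF.cont σ).comp_continuous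
          (f := fun p : D.obj (σ.obj 0) × Simplex m => (p.1, stdSimplex.map θ p.2))
          (continuous_fst.prodMk ((continuous_stdSimplex_map θ).comp continuous_snd))
          fun p => (hθ p.2).1).congr fun p => ((hθ p.2).2 p.1).2.symm
  · rintro p ⟨m, hm, σ, x, t, rfl⟩
    rcases (Nat.lt_succ_iff.1 hm).lt_or_eq with hm | rfl
    · have := cell_mem_skeleton hm σ x t
      rw [hF1 _ this, hF.zero _ this]
    · by_cases hσ : Nondegenerate σ
      · rw [hF2 σ hσ (x, t), hE0]
        rfl
      · obtain ⟨θ, hθ⟩ := hF3 σ hσ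
        rw [((hθ t).2 x).2, hF.zero _ (cell_mem_skeleton_of_boundary (hθ t).1), ← ((hθ t).2 x).1]
  · rcases (Nat.lt_succ_iff.1 hm).lt_or_eq with hm | rfl
    · rw [hF1 _ (cell_mem_skeleton hm σ _ t), hF.base m hm σ t]
    · by_cases hσ : Nondegenerate σ
      · rw [hF2 σ hσ (base _, t), hEγ]
      · obtain ⟨θ, hθ⟩ := hF3 σ hσ
        rw [((hθ t).2 _).2, hF.boundary hbase σ (hθ t).1]

/-- The homotopy extension property of the inclusion of the base points in the homotopy colimit,
for homotopies that are constant along the base points. -/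
theorem exists_extension_hocolim (hbase : ∀ {i j : J} (g : i ⟶ j), D.map g (base i) = base j)
    (hep : ∀ j, HasHomotopyExtension (incl ({base j} : Set (D.obj j))))
    (hf : ∀ {n : ℕ} (σ : ComposableArrows J n) (t : Simplex n), f (cell σ (base _) t) = γ 0) :
    ∃ F : C(Hocolim D, C(unitInterval, Z)), (∀ p, F p 0 = f p) ∧
      ∀ {n : ℕ} (σ : ComposableArrows J n) (t : Simplex n), F (cell σ (base _) t) = γ := by
  have h0 : IsPartialExtension base f γ 0 fun p => ContinuousMap.const unitInterval (f p) :=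
    ⟨fun m hm => absurd hm (Nat.not_lt_zero m), fun p _ => rfl,
      fun m hm => absurd hm (Nat.not_lt_zero m)⟩
  choose step hstep hagree using fun (n : ℕ)
    (F : {F : Hocolim D → C(unitInterval, Z) // IsPartialExtension base f γ n F}) =>
      F.2.exists_succ hbase hep hf
  let S : ∀ n : ℕ, {F : Hocolim D → C(unitInterval, Z) // IsPartialExtension base f γ n F} :=
    fun n => Nat.rec ⟨_, h0⟩ (fun n F => ⟨step n F, hstep n F⟩) n
  have hS : ∀ n, ∀ p ∈ skeleton D n, (S (n + 1)).1 p = (S n).1 p := fun n p hp =>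
    hagree n (S n) p hp
  have hS' : ∀ n k, ∀ p ∈ skeleton D n, (S (n + k)).1 p = (S n).1 p := by
    intro n k p hp
    induction k with
    | zero => rfl
    | succ k ih => exact (hS (n + k) p (skeleton_mono (Nat.le_add_right n k) hp)).trans ih
  have hex : ∀ p : Hocolim D, ∃ n, p ∈ skeleton D n := fun p => by
    obtain ⟨n, σ, x, t, rfl⟩ := exists_cell p
    exact ⟨n + 1, cell_mem_skeleton n.lt_succ_self σ x t⟩
  -- The stages stabilise on each skeleton, so the limit at `p` can be read off at any stage whose
  -- skeleton contains `p`.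
  choose d hd using hex
  have hlim : ∀ n, ∀ p ∈ skeleton D n, (S (d p)).1 p = (S n).1 p := by
    intro n p hp
    rw [← hS' n (d p) p hp, ← hS' (d p) n p (hd p), Nat.add_comm]
  refine ⟨⟨fun p => (S (d p)).1 p, continuous_hocolim_iff.2 fun n σ => ?_⟩,
    fun p => (S (d p)).2.zero p (hd p), fun {n} σ t => ?_⟩
  · exact ((S (n + 1)).2.cont n n.lt_succ_self σ).congr fun p =>
      (hlim (n + 1) _ (cell_mem_skeleton n.lt_succ_self σ _ _)).symm
  · exact (hlim (n + 1) _ (cell_mem_skeleton n.lt_succ_self σ _ _)).trans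
      ((S (n + 1)).2.base n n.lt_succ_self σ t)

/-- The base points of the spaces of the diagram form a closed subset of the homotopy colimit. -/
theorem isClosed_base (hbase : ∀ {i j : J} (g : i ⟶ j), D.map g (base i) = base j)
    (hcl : ∀ j, IsClosed ({base j} : Set (D.obj j))) :
    IsClosed {p : Hocolim D | ∃ (n : ℕ) (σ : ComposableArrows J n) (t : Simplex n),
      cell σ (base _) t = p} := by
  -- Vertices with zero coordinate must be exempt: `x` may differ from the base point and yet be
  -- pushed to it at every vertex that counts. In this form the condition is invariant under faces
  -- and degeneracies, and it is closed on each cell.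
  let P : Hocolim D → Prop := Hocolim.lift (fun σ x t => ∀ i, t i = 0 ∨ push σ i x = base _)
    fun θ σ x t => propext ⟨fun h j => ?_, fun h i => ?_⟩
  · have hP : {p : Hocolim D | ∃ (n : ℕ) (σ : ComposableArrows J n) (t : Simplex n),
        cell σ (base _) t = p} = {p | P p} := by
      ext p
      constructor
      · rintro ⟨n, σ, t, rfl⟩ i
        exact Or.inr (hbase _)
      · intro hp
        obtain ⟨n, σ, x, t, rfl⟩ := exists_cell p
        obtain ⟨m, θ, t', rfl, ht'⟩ := exists_face t
        refine ⟨m, pull θ σ, t', ?_⟩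
        rw [← cell_pull θ σ x t']
        exact congrArg (fun y => cell (pull θ σ) y t')
          ((hp (θ 0)).resolve_left (stdSimplex_map_apply_pos (ht' 0)).ne').symm
    rw [hP, ← isOpen_compl_iff]
    refine continuous_Prop.1 (continuous_hocolim_iff.2 fun n σ => continuous_Prop.2 ?_)
    have : IsClosed {p : D.obj (σ.obj 0) × Simplex n |
        ∀ i, p.2 i = 0 ∨ push σ i p.1 = base _} := by
      simp only [Set.ofPred_forall]
      refine isClosed_iInter fun i => ?_
      exact (isClosed_eq ((continuous_coord i).comp continuous_snd) continuous_const).union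
        ((hcl _).preimage ((continuous_push i).comp continuous_fst))
    exact this.isOpen_compl
  · rcases (((stdSimplex.map θ t).2.1 j).eq_or_lt) with h0 | h0
    · exact Or.inl h0.symm
    · obtain ⟨i, rfl, hi⟩ := exists_of_stdSimplex_map_apply_pos h0
      exact Or.inr ((push_pull θ i x).symm.trans ((h i).resolve_left hi.ne'))
  · rcases (t.2.1 i).eq_or_lt with h0 | h0
    · exact Or.inl h0.symm
    · exact Or.inr ((push_pull θ i x).trans
        ((h (θ i)).resolve_left (stdSimplex_map_apply_pos h0).ne'))

end Skeleta

/-! ### Wellpointedness of the based homotopy colimit -/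

section BasedHomotopyColimits

variable {J : Type u} [SmallCategory J] (D : J ⥤ BasedTop.{u})

theorem map_basePoint {i j : J} (g : i ⟶ j) :
    (underlying D).map g (BasedTop.pt (D.obj i)) = BasedTop.pt (D.obj j) :=
  ConcreteCategory.congr_hom (Under.w (D.map g)) PUnit.unit

theorem range_classifyingSpaceMap : Set.range (classifyingSpaceMap D) =
    {p | ∃ (n : ℕ) (σ : ComposableArrows J n) (t : Simplex n),
      cell (D := underlying D) σ (BasedTop.pt (D.obj (σ.obj 0))) t = p} := by
  ext p
  constructor
  · rintro ⟨q, rfl⟩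
    obtain ⟨⟨n, σ, t⟩, rfl⟩ := Quot.exists_rep q
    exact ⟨n.len, σ, t, rfl⟩
  · rintro ⟨n, σ, t, rfl⟩
    let q : PreRealization (discreteNerve J) := ⟨SimplexCategory.mk n, σ, t⟩
    exact ⟨Quot.mk _ q, rfl⟩

theorem isWellpointed_basedHocolim
    (h : ∀ j, IsWellpointed (D.obj j).right (BasedTop.pt (D.obj j))) :
    IsWellpointed (BasedHocolim D) (BasedHocolim.pt D) := by
  refine ⟨Collapse.isClosed_pt _ ?_, fun Z _ f h' hh => ?_⟩
  · rw [range_classifyingSpaceMap]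
    exact isClosed_base (D := underlying D) (base := fun j => BasedTop.pt (D.obj j))
      (map_basePoint D) fun j => (h j).1
  · let q := Collapse.proj (classifyingSpaceMap D)
    let γ : C(unitInterval, Z) := h'.curry ⟨BasedHocolim.pt D, rfl⟩
    have hmem : ∀ {n : ℕ} (σ : ComposableArrows J n) (t : Simplex n),
        cell (D := underlying D) σ (BasedTop.pt (D.obj (σ.obj 0))) t ∈
          Set.range (classifyingSpaceMap D) := fun σ t => by
      rw [range_classifyingSpaceMap]
      exact ⟨_, σ, t, rfl⟩
    have h0 : f (BasedHocolim.pt D) = γ 0 := (hh ⟨BasedHocolim.pt D, rfl⟩).symm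
    obtain ⟨F, F0, F1⟩ := exists_extension_hocolim (D := underlying D)
      (base := fun j => BasedTop.pt (D.obj j)) (f := f.comp q) (γ := γ) (map_basePoint D)
      (fun j => (h j).2) fun σ t => by
        rw [← h0]
        exact congrArg f ((Collapse.proj_eq_pt_iff _ _).2 (hmem σ t))
    have F2 : ∀ a, F (classifyingSpaceMap D a) = γ := fun a => by
      have ha : classifyingSpaceMap D a ∈ Set.range (classifyingSpaceMap D) := ⟨a, rfl⟩
      rw [range_classifyingSpaceMap] at ha
      obtain ⟨n, σ, t, ha⟩ := ha
      rw [← ha, F1]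
    -- `F` takes the constant value `γ` on the image of `BJ`, so it descends; the added point also
    -- gets `γ`, which covers empty `J`.
    let G : C(BasedHocolim D, C(unitInterval, Z)) :=
      ⟨Quot.lift (Sum.elim F fun _ => γ) (by
        rintro _ _ ⟨a⟩
        exact F2 a), continuous_quot_lift _ (F.continuous.sumElim continuous_const)⟩
    refine ⟨G.uncurry, fun y => ?_, ?_⟩
    · change G y 0 = f y
      rcases Collapse.cases _ y with rfl | ⟨x, rfl⟩
      · exact h0.symm
      · exact F0 x
    · rintro ⟨_, rfl⟩ t
      rfl

end BasedHomotopyColimits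

end NumerablyContractible

theorem corollary4p2 (J : Type u) [SmallCategory J] :
    (∀ D : J ⥤ TopCat.{u},
      (∀ j, NumerablyContractible.IsDoldSpace (D.obj j)) →
        NumerablyContractible.IsDoldSpace (NumerablyContractible.Hocolim D)) ∧
    (∀ D : J ⥤ NumerablyContractible.BasedTop.{u},
      (∀ j, NumerablyContractible.IsWellpointed (D.obj j).right
          (NumerablyContractible.BasedTop.pt (D.obj j)) ∧
        NumerablyContractible.IsDoldSpace (D.obj j).right) →
      NumerablyContractible.IsWellpointed (NumerablyContractible.BasedHocolim D)
          (NumerablyContractible.BasedHocolim.pt D) ∧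
        NumerablyContractible.IsDoldSpace (NumerablyContractible.BasedHocolim D)) := by
  refine ⟨fun D h => NumerablyContractible.isDoldSpace_hocolim h, fun D h => ?_⟩
  have hw := NumerablyContractible.isWellpointed_basedHocolim D fun j => (h j).1
  exact ⟨hw, NumerablyContractible.Collapse.isDoldSpace _
    (NumerablyContractible.isDoldSpace_hocolim fun j => (h j).2) hw⟩
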